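/- Consider the Congested Clique model on $n\ge 2$ nodes: computation proceeds in synchronous rounds, in each round every node may send a (possibly different) message of $O(\log n)$ bits to every other node, and local computation is unrestricted. The input is an undirected weighted graph $G=(V,E,w)$ with $|V|=n$, $|E|=m$ and polynomially bounded positive integer weights, $w(e)\in\{1,\dots,n^{a}\}$ for a constant $a$; initially each node knows its identifier, its incident edges and their weights, and has private random bits. Write $d_G$ for the weighted shortest-path distance ($\infty$ between different components). For $k\ge 2$ and $0<\epsilon\le 1$ put $$\beta=\frac{\log^2 n}{\epsilon}\Bigl(\frac{\log n\,\log k}{\epsilon}\Bigr)^{\log(k+1)-1},$$ with all logarithms to base $2$. For all constants $a,c,d\in\mathbb N$ there is a constant $C$, depending only on $a,c,d$, such that for all $n\ge2$, $k\ge 2$ and $0<\epsilon\le1$ there are a randomized preprocessing algorithm and a deterministic query algorithm in the Congested Clique, with messages and memory words of $C\lceil\log n\rceil$ bits, such that for every $G$ as above: 1. the preprocessing takes at most $C\beta\log^2 n$ rounds, and at its end the nodes store a data structure of at most $C\,(m+n^{1+1/(2k)})$ words in total; 2. a query starts from the stored words alone, each node knowing in addition only whether it belongs to the set $S$ of sources,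 and takes at most $C\beta$ rounds; 3. with probability at least $1-n^{-d}$ over the random bits of the preprocessing, for every set $S\subseteq V$ of at most $c\sqrt n$ sources, after the query for $S$ every node $v\in V$ knows for each $s\in S$ an estimate $\tilde d(s,v)$ with $d_G(s,v)\le\tilde d(s,v)\le(1+\epsilon)\,d_G(s,v)$. -/

import Mathlib

open scoped ENNReal

noncomputable section

/-- A word (equivalently, a message) of `B` bits. -/
abbrev Word (B : ℕ) : Type := Fin B → Bool

/-- A synchronous protocol on the clique with node set `Fin n`, where in every round every node
sends a (possibly different) `B`-bit message to every node.  `I` is the type of local inputs,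
`O` the type of local outputs.  A node knows its own identifier and its local state; local
computation is unrestricted.  `rounds` is the number of communication rounds. -/
structure CliqueProtocol (n B : ℕ) (I O : Type) where
  State : Type
  init : Fin n → I → State
  /-- `send v σ u` is the message that node `v` in state `σ` sends to node `u`. -/
  send : Fin n → State → Fin n → Word B
  /-- `receive v σ μ` is the next state of node `v`, where `μ u` is the message from `u`. -/
  receive : Fin n → State → (Fin n → Word B) → State
  output : Fin n → State → O
  rounds : ℕ

namespace CliqueProtocol

variable {n B : ℕ} {I O : Type}

/-- The local states of all nodes after `t` rounds on the local inputs `x`. -/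
def states (P : CliqueProtocol n B I O) (x : Fin n → I) : ℕ → Fin n → P.State
  | 0 => fun v => P.init v (x v)
  | t + 1 => fun v => P.receive v (P.states x t v) (fun u => P.send u (P.states x t u) v)

/-- The local outputs of all nodes at the end of the protocol. -/
def run (P : CliqueProtocol n B I O) (x : Fin n → I) (v : Fin n) : O :=
  P.output v (P.states x P.rounds v)

end CliqueProtocol

/-- An undirected graph on the nodes `Fin n` with natural-number edge weights
(the values of `w` off the edge set are irrelevant). -/
structure WGraph (n : ℕ) where
  graph : SimpleGraph (Fin n)
  w : Sym2 (Fin n) → ℕ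

namespace WGraph

variable {n : ℕ}

/-- The number of edges. -/
def numEdges (G : WGraph n) : ℕ := G.graph.edgeSet.ncard

/-- All edge weights lie in `{1, …, n ^ a}`. -/
def PolyWeights (G : WGraph n) (a : ℕ) : Prop :=
  ∀ e ∈ G.graph.edgeSet, 1 ≤ G.w e ∧ G.w e ≤ n ^ a

/-- The total weight of a walk. -/
def walkWeight (G : WGraph n) {u v : Fin n} (p : G.graph.Walk u v) : ℕ :=
  (p.edges.map G.w).sum

/-- The weighted shortest-path distance, `∞` between different connected components. -/
def dist (G : WGraph n) (u v : Fin n) : ℝ≥0∞ :=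
  ⨅ p : G.graph.Walk u v, (G.walkWeight p : ℝ≥0∞)

open Classical in
/-- The part of the graph that node `v` knows initially: its incident edges and their weights. -/
def localView (G : WGraph n) (v : Fin n) : Fin n → Option ℕ :=
  fun u => if G.graph.Adj v u then some (G.w s(v, u)) else none

end WGraph

/-- The private random bits of a node. -/
abbrev Coins (r : ℕ) : Type := Fin r → Bool

/-- A randomized preprocessing protocol whose local input is the local view of the graph together
with `r` private random bits, and whose local output is the list of words that the node stores. -/
abbrev Preprocessing (n B r : ℕ) : Type 1 :=
  CliqueProtocol n B ((Fin n → Option ℕ) × Coins r) (List (Word B))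

/-- A query protocol: a node starts with nothing but its stored words and the bit that tells
whether it is a source; it outputs one distance estimate for every source (the entries of the
output for non-sources are irrelevant). -/
abbrev Query (n B : ℕ) : Type 1 :=
  CliqueProtocol n B (List (Word B) × Bool) (Fin n → ℝ≥0∞)

/-- The data structure (the words stored by each node) that `P` builds for `G` when the random
bits of the nodes are `ω`. -/
def Preprocessing.build {n B r : ℕ} (P : Preprocessing n B r) (G : WGraph n)
    (ω : Fin n → Coins r) : Fin n → List (Word B) :=
  CliqueProtocol.run P (fun v => (G.localView v, ω v))

/-- The total number of words of a data structure. -/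
def dataSize {n B : ℕ} (D : Fin n → List (Word B)) : ℕ := ∑ v, (D v).length

/-- `Q.answer D S v s` is the estimate of the distance from `s` to `v` that node `v` outputs when
the data structure `D` is queried with the set of sources `S`. -/
def Query.answer {n B : ℕ} (Q : Query n B) (D : Fin n → List (Word B))
    (S : Finset (Fin n)) (v s : Fin n) : ℝ≥0∞ :=
  CliqueProtocol.run Q (fun u => (D u, decide (u ∈ S))) v s

/-- The probability of an event under independent fair random bits at all nodes. -/
def coinProb {n r : ℕ} (E : Set (Fin n → Coins r)) : ℝ :=
  (E.ncard : ℝ) / (Fintype.card (Fin n → Coins r) : ℝ)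

/-- `(log² n / ε) · (log n · log k / ε) ^ (log (k + 1) - 1)`, logarithms to base two. -/
def hopBeta (n : ℕ) (k ε : ℝ) : ℝ :=
  Real.logb 2 n ^ 2 / ε * (Real.logb 2 n * Real.logb 2 k / ε) ^ (Real.logb 2 (k + 1) - 1)

end

/-! The parameter `k` of the theorem plays no role in the construction. The second factor of
`hopBeta` is at least 1 and `n ^ (1 + 1 / (2 * k))` is at least `n`, so it suffices to preprocess
and to query in O(log² n / ε) rounds and to store O(m + n) words.

Let `q` be about √n. The communication primitive is a min-plus product in which every row keeps only
its `q * t` smallest entries; it takes O(1 + t) rounds (`realizes_filteredProduct`). Squaring about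
log n times with t of order log n gives every node its exact distances to its `q * t` nearest nodes
(`IsPathMetric.nearest_eq`). These distances become shortcut edges. Multiplying repeatedly with t
constant gives h-hop distances from O(√n) sources in O(h) rounds (`relax_le_hopDist`).

One node samples at most `q` pivots. With high probability every node has a pivot among its `q * t`
nearest nodes (`exists_sampler`), and nothing else is random; the event does not mention the source
set, so one success serves all queries. On a shortest path of length D, shortcuts advance by more
than D/m in two hops unless a pivot lies within D/m. Walking from both ends, one therefore arrives
after O(m) hops, or meets a pivot near each end, and an edge between the two pivots bridges the gap
at the price of a detour of at most 4D/m (`IsPathMetric.exists_hopDist_le_of_approxOn`). Such pivot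
edges are built scale by scale: edges that are good up to distance ρ yield paths with O(m) hops up
to 3ρ/2, each scale costing a factor 1 + 4/m (`IsPathMetric.approxOn_pivotEdges`). With J = O(log n)
scales and m about 8(J + 1)/ε the total error is at most 1 + ε.

Only the graph and the edges between pivots, at most q² ≤ 4n of them, are stored. A query recomputes
the shortcuts in O(log² n) rounds and then relaxes from the sources for O(log n / ε) rounds. -/

/-! ### Functions computable on the clique -/

/-- The global function `f`, from local inputs to local outputs, is computed by some protocol
with `t` rounds and `B`-bit messages. -/
def Realizes (n B t : ℕ) {α β : Type} (f : (Fin n → α) → Fin n → β) : Prop :=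
  ∃ P : CliqueProtocol n B α β, P.rounds = t ∧ ∀ x v, P.run x v = f x v

namespace CliqueProtocol

/-- Run `P` on a part of the local input, and combine its output with the local input. -/
def withLocal {n B : ℕ} {α β γ δ : Type} (P : CliqueProtocol n B α β) (p : Fin n → γ → α)
    (g : Fin n → γ → β → δ) : CliqueProtocol n B γ δ where
  State := γ × P.State
  init v x := (x, P.init v (p v x))
  send v σ u := P.send v σ.2 u
  receive v σ μ := (σ.1, P.receive v σ.2 μ)
  output v σ := g v σ.1 (P.output v σ.2)
  rounds := P.rounds

theorem withLocal_states {n B : ℕ} {α β γ δ : Type} (P : CliqueProtocol n B α β)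
    (p : Fin n → γ → α) (g : Fin n → γ → β → δ) (x : Fin n → γ) (t : ℕ) :
    (P.withLocal p g).states x t = fun v => (x v, P.states (fun u => p u (x u)) t v) := by
  induction t with
  | zero => rfl
  | succ t ih =>
    funext v
    simp only [states, ih]
    rfl

/-- Run `P`, and then `Q` on the outputs of `P`. -/
def seq {n B : ℕ} {α β γ : Type} (P : CliqueProtocol n B α β) (Q : CliqueProtocol n B β γ) :
    CliqueProtocol n B α γ where
  State := ℕ × P.State × Option Q.State
  init v x := (0, P.init v x,
    -- The hand-over takes place inside the step that completes round `P.rounds`, and already at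
    -- initialization if there are no rounds. The counter makes all nodes switch simultaneously.
    if P.rounds = 0 then some (Q.init v (P.output v (P.init v x))) else none)
  send v σ u := match σ.2.2 with
    | none => P.send v σ.2.1 u
    | some τ => Q.send v τ u
  receive v σ μ := match σ.2.2 with
    | none => (σ.1 + 1, P.receive v σ.2.1 μ,
        if P.rounds = σ.1 + 1 then some (Q.init v (P.output v (P.receive v σ.2.1 μ))) else none)
    | some τ => (σ.1 + 1, σ.2.1, some (Q.receive v τ μ))
  output v σ := match σ.2.2 with
    | none => Q.output v (Q.init v (P.output v σ.2.1))
    | some τ => Q.output v τ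
  rounds := P.rounds + Q.rounds

theorem seq_states_left {n B : ℕ} {α β γ : Type} (P : CliqueProtocol n B α β)
    (Q : CliqueProtocol n B β γ) (x : Fin n → α) (t : ℕ) (ht : t ≤ P.rounds) :
    (P.seq Q).states x t = fun v => (t, P.states x t v,
      if P.rounds = t then some (Q.init v (P.output v (P.states x t v))) else none) := by
  induction t with
  | zero => rfl
  | succ t ih =>
    have h : P.rounds ≠ t := by omega
    funext v
    simp only [states, ih (by omega), if_neg h]
    rfl

theorem seq_states_right {n B : ℕ} {α β γ : Type} (P : CliqueProtocol n B α β)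
    (Q : CliqueProtocol n B β γ) (x : Fin n → α) (t : ℕ) :
    (P.seq Q).states x (P.rounds + t) = fun v => (P.rounds + t, P.states x P.rounds v,
      some (Q.states (P.run x) t v)) := by
  induction t with
  | zero =>
    rw [Nat.add_zero, seq_states_left P Q x _ le_rfl]
    simp only [if_true]
    rfl
  | succ t ih =>
    funext v
    rw [← Nat.add_assoc]
    simp only [states, ih]
    rfl

end CliqueProtocol

namespace Realizes

variable {n B : ℕ} {α β γ δ : Type}

theorem withLocal {t : ℕ} {f : (Fin n → α) → Fin n → β} (hf : Realizes n B t f)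
    (p : Fin n → γ → α) (g : Fin n → γ → β → δ) :
    Realizes n B t (fun x v => g v (x v) (f (fun u => p u (x u)) v)) := by
  obtain ⟨P, rfl, hP⟩ := hf
  refine ⟨P.withLocal p g, rfl, fun x v => ?_⟩
  beta_reduce
  rw [← hP]
  simp only [CliqueProtocol.run, CliqueProtocol.withLocal_states]
  rfl

theorem comp {s t : ℕ} {f : (Fin n → α) → Fin n → β} {g : (Fin n → β) → Fin n → γ}
    (hg : Realizes n B t g) (hf : Realizes n B s f) :
    Realizes n B (s + t) (fun x => g (f x)) := by
  obtain ⟨P, rfl, hP⟩ := hf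
  obtain ⟨Q, rfl, hQ⟩ := hg
  refine ⟨P.seq Q, rfl, fun x v => ?_⟩
  have h : P.run x = f x := funext (hP x)
  beta_reduce
  rw [← hQ, ← h]
  simp only [CliqueProtocol.run]
  rw [show (P.seq Q).rounds = P.rounds + Q.rounds from rfl, CliqueProtocol.seq_states_right]
  rfl

theorem ofLocal (g : Fin n → α → β) : Realizes n B 0 (fun x v => g v (x v)) :=
  ⟨{ State := α, init := fun _ x => x, send := fun _ _ _ => default,
     receive := fun _ σ _ => σ, output := g, rounds := 0 }, rfl, fun _ _ => rfl⟩

theorem iterate {t : ℕ} {f : (Fin n → α) → Fin n → α} (hf : Realizes n B t f) (k : ℕ) :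
    Realizes n B (k * t) (f^[k]) := by
  induction k with
  | zero =>
    rw [Nat.zero_mul]
    exact ofLocal (fun _ x => x)
  | succ k ih =>
    rw [Nat.succ_mul, Nat.add_comm, Function.iterate_succ]
    exact ih.comp hf

/-- In `t` rounds every node sends `t` symbols of a small alphabet to every node. -/
theorem exchange {M : Type} [Fintype M] [Inhabited M] (hM : Fintype.card M ≤ 2 ^ B) (t : ℕ)
    (msg : Fin n → α → Fin n → Fin t → M) :
    Realizes n B t (fun x v u => msg u (x u) v) := by
  obtain ⟨enc⟩ : Nonempty (M ↪ Word B) :=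
    Function.Embedding.nonempty_of_card_le (by simpa using hM)
  let P : CliqueProtocol n B α (Fin n → Fin t → M) :=
    { State := ℕ × α × (Fin n → Fin t → M)
      init := fun _ x => (0, x, default)
      send := fun v σ u => if h : σ.1 < t then enc (msg v σ.2.1 u ⟨σ.1, h⟩) else default
      receive := fun _ σ μ =>
        (σ.1 + 1, σ.2.1, fun u j => if j.1 = σ.1 then Function.invFun enc (μ u) else σ.2.2 u j)
      output := fun _ σ => σ.2.2
      rounds := t }
  have hs : ∀ x i, i ≤ t → P.states x i =
      fun v => (i, x v, fun u j => if j.1 < i then msg u (x u) v j else default) := by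
    intro x i
    induction i with
    | zero => intro _; funext v; simp [CliqueProtocol.states, P, Pi.default_def]
    | succ i ih =>
      intro hi
      funext v
      simp only [CliqueProtocol.states, ih (by omega)]
      simp only [P, show i < t by omega, dif_pos, Prod.mk.injEq, true_and]
      funext u j
      rw [Function.leftInverse_invFun enc.injective]
      by_cases h1 : j.1 = i
      · rw [if_pos h1, if_pos (by omega)]; congr 1; exact (Fin.ext h1).symm
      · rw [if_neg h1]; congr 1; simp only [eq_iff_iff]; omega
  refine ⟨P, rfl, fun x v => ?_⟩
  simp only [CliqueProtocol.run]
  rw [show P.rounds = t from rfl, hs x t le_rfl]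
  funext u j
  simp [P]

/-- Oblivious two-hop routing: if the fixed routes put at most `c` messages on every pair
of nodes in either hop, then all messages are delivered in `2 * c` rounds. -/
theorem route {M : Type} [Fintype M] [Inhabited M] (hM : Fintype.card M ≤ 2 ^ B) {K : Type} {c : ℕ}
    (src mid dst : K → Fin n) (i₁ i₂ : K → Fin c)
    (h₁ : ∀ k l, src k = src l → mid k = mid l → i₁ k = i₁ l → k = l)
    (h₂ : ∀ k l, mid k = mid l → dst k = dst l → i₂ k = i₂ l → k = l)
    (content : Fin n → α → K → M) :
    ∃ f : (Fin n → α) → Fin n → K → M, Realizes n B (2 * c) f ∧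
      ∀ x k, f x (dst k) k = content (src k) (x (src k)) k := by
  classical
  -- The routes are known to all nodes, so messages carry no header: by `h₁` and `h₂` a pair of
  -- nodes and a slot determine the message `k`. The resulting `f` is meaningful only at `dst k`.
  have hop1 := exchange (B := B) (n := n) hM c (fun u (x : α) v i =>
    if h : ∃ k, src k = u ∧ mid k = v ∧ i₁ k = i then content u x h.choose else default)
  have hop2 := exchange (B := B) (n := n) hM c (fun u (y : Fin n → Fin c → M) v i =>
    if h : ∃ k, mid k = u ∧ dst k = v ∧ i₂ k = i then y (src h.choose) (i₁ h.choose) else default)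
  have H := (hop2.comp hop1).withLocal (fun _ x => x)
    (fun _ _ (y : Fin n → Fin c → M) k => y (mid k) (i₂ k))
  rw [← two_mul] at H
  refine ⟨_, H, fun x k => ?_⟩
  have e2 : ∃ l, mid l = mid k ∧ dst l = dst k ∧ i₂ l = i₂ k := ⟨k, rfl, rfl, rfl⟩
  have e2' : e2.choose = k :=
    h₂ _ _ e2.choose_spec.1 e2.choose_spec.2.1 e2.choose_spec.2.2
  have e1 : ∃ l, src l = src k ∧ mid l = mid k ∧ i₁ l = i₁ k := ⟨k, rfl, rfl, rfl⟩
  have e1' : e1.choose = k :=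
    h₁ _ _ e1.choose_spec.1 e1.choose_spec.2.1 e1.choose_spec.2.2
  simp only [dif_pos e2]
  rw [e2', dif_pos e1, e1']

end Realizes

/-! ### The `k` smallest entries of a vector -/

/-- Position `t` precedes position `s` when the entries of `x` are sorted, ties broken by index. -/
def Precedes {n : ℕ} (x : Fin n → ℕ∞) (t s : Fin n) : Prop :=
  x t < x s ∨ (x t = x s ∧ t < s)

open Classical in
/-- The number of positions that precede `s`. -/
noncomputable def rankOf {n : ℕ} (x : Fin n → ℕ∞) (s : Fin n) : ℕ :=
  (Finset.univ.filter (fun t => Precedes x t s)).card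

open Classical in
/-- Keep the `k` smallest entries, replace the others by `⊤`. -/
noncomputable def keepSmallest {n : ℕ} (k : ℕ) (x : Fin n → ℕ∞) (s : Fin n) : ℕ∞ :=
  if rankOf x s < k then x s else ⊤

section KeepSmallest

variable {n k : ℕ} {x y : Fin n → ℕ∞} {s t : Fin n}

theorem Precedes.trans {r : Fin n} (h₁ : Precedes x r s) (h₂ : Precedes x s t) :
    Precedes x r t := by
  rcases h₁ with h₁ | ⟨h₁, h₁'⟩ <;> rcases h₂ with h₂ | ⟨h₂, h₂'⟩
  · exact Or.inl (h₁.trans h₂)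
  · exact Or.inl (h₂ ▸ h₁)
  · exact Or.inl (h₁ ▸ h₂)
  · exact Or.inr ⟨h₁.trans h₂, h₁'.trans h₂'⟩

theorem not_precedes_self : ¬ Precedes x s s := by simp [Precedes]

theorem precedes_total (h : s ≠ t) : Precedes x s t ∨ Precedes x t s := by
  rcases lt_trichotomy (x s) (x t) with h1 | h1 | h1
  · exact Or.inl (Or.inl h1)
  · rcases lt_or_gt_of_ne h with h2 | h2
    · exact Or.inl (Or.inr ⟨h1, h2⟩)
    · exact Or.inr (Or.inr ⟨h1.symm, h2⟩)
  · exact Or.inr (Or.inl h1)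

theorem rankOf_le_rankOf (h : ∀ r, Precedes x r s → Precedes y r t) :
    rankOf x s ≤ rankOf y t := by
  classical
  exact Finset.card_le_card (fun r => by simpa using h r)

theorem rankOf_lt_rankOf (h : Precedes x s t) : rankOf x s < rankOf x t := by
  classical
  refine Finset.card_lt_card ((Finset.ssubset_iff_of_subset ?_).2 ⟨s, ?_, ?_⟩)
  · intro r; simpa using fun hr => Precedes.trans hr h
  · simpa using h
  · simpa using not_precedes_self

theorem rankOf_injective (x : Fin n → ℕ∞) : Function.Injective (rankOf x) := by
  intro s t h
  by_contra hne
  rcases precedes_total (x := x) hne with h1 | h1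
  · exact (rankOf_lt_rankOf h1).ne h
  · exact (rankOf_lt_rankOf h1).ne' h

theorem rankOf_lt (x : Fin n → ℕ∞) (s : Fin n) : rankOf x s < n := by
  classical
  have : rankOf x s < (Finset.univ : Finset (Fin n)).card :=
    Finset.card_lt_card ((Finset.ssubset_iff_of_subset (Finset.subset_univ _)).2
      ⟨s, Finset.mem_univ _, by simpa using not_precedes_self⟩)
  simpa using this

theorem card_rankOf_lt (x : Fin n → ℕ∞) (k : ℕ) :
    (Finset.univ.filter (fun s => rankOf x s < k)).card = min k n := by
  classical
  have himg : Finset.univ.image (rankOf x) = Finset.range n := by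
    apply Finset.eq_of_subset_of_card_le
    · intro i; simp only [Finset.mem_image, Finset.mem_univ, true_and, Finset.mem_range]
      rintro ⟨s, rfl⟩; exact rankOf_lt x s
    · rw [Finset.card_image_of_injective _ (rankOf_injective x)]; simp
  rw [← Finset.card_image_of_injective _ (rankOf_injective x),
    ← Finset.filter_image (p := fun i => i < k), himg]
  rw [show (Finset.range n).filter (· < k) = Finset.range (min k n) by
    ext i; simp; omega]
  simp

theorem le_keepSmallest : x s ≤ keepSmallest k x s := by
  unfold keepSmallest; split_ifs <;> simp

theorem keepSmallest_of_lt (h : rankOf x s < k) : keepSmallest k x s = x s := if_pos h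

/-- An entry on which `y` agrees with a pointwise smaller `x` has no larger rank in `y`. -/
theorem rankOf_le_of_le (hxy : ∀ r, x r ≤ y r) (hs : y s = x s) : rankOf y s ≤ rankOf x s := by
  apply rankOf_le_rankOf
  rintro r (h | ⟨h, h'⟩)
  · exact Or.inl ((hxy r).trans_lt (hs ▸ h))
  · rcases (hxy r).lt_or_eq with h2 | h2
    · exact Or.inl (h2.trans_eq (h.trans hs))
    · exact Or.inr ⟨h2.trans (h.trans hs), h'⟩

theorem keepSmallest_eq_self (S : Finset (Fin n)) (hS : S.card ≤ k) (h : ∀ s ∉ S, x s = ⊤) :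
    keepSmallest k x = x := by
  classical
  funext s
  by_cases hs : x s = ⊤
  · unfold keepSmallest; split_ifs <;> simp [hs]
  · apply keepSmallest_of_lt
    have hsS : s ∈ S := by by_contra h1; exact hs (h s h1)
    refine lt_of_lt_of_le (Finset.card_lt_card ((Finset.ssubset_iff_of_subset ?_).2
      ⟨s, hsS, by simpa using not_precedes_self⟩)) hS
    intro t
    simp only [Finset.mem_filter, Finset.mem_univ, true_and]
    intro ht
    by_contra htS
    rcases ht with h1 | ⟨h1, _⟩
    · rw [h t htS] at h1; simp at h1
    · exact hs (h1.symm.trans (h t htS))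

/-- Raising entries outside the `k` smallest cannot bring them in: the `k` smallest keep their
values, so they still precede all the others. -/
theorem keepSmallest_eq_of_agree (hxy : ∀ r, x r ≤ y r)
    (h : ∀ r, rankOf x r < k → y r = x r) : keepSmallest k y = keepSmallest k x := by
  classical
  funext s
  by_cases hs : rankOf x s < k
  · rw [keepSmallest_of_lt hs, keepSmallest_of_lt ((rankOf_le_of_le hxy (h s hs)).trans_lt hs),
      h s hs]
  · rw [keepSmallest, keepSmallest, if_neg hs, if_neg]
    rw [not_lt] at hs ⊢
    have hk : k ≤ n := hs.trans (rankOf_lt x s).le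
    have hc := card_rankOf_lt x k
    rw [min_eq_left hk] at hc
    rw [← hc]
    apply Finset.card_le_card
    intro t
    simp only [Finset.mem_filter, Finset.mem_univ, true_and]
    intro ht
    have hts : Precedes x t s := by
      rcases eq_or_ne t s with rfl | hne
      · omega
      · rcases precedes_total (x := x) hne with h1 | h1
        · exact h1
        · have := rankOf_lt_rankOf h1; omega
    rcases hts with h1 | ⟨h1, h2⟩
    · exact Or.inl (h t ht ▸ h1.trans_le (hxy s))
    · rcases (hxy s).lt_or_eq with h3 | h3
      · exact Or.inl (by rw [h t ht, h1]; exact h3)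
      · exact Or.inr ⟨by rw [h t ht, h1, h3], h2⟩

/-- Selecting the smallest entries commutes with merging. -/
theorem keepSmallest_iInf_keepSmallest {ι : Type} [Nonempty ι] (z : ι → Fin n → ℕ∞) :
    keepSmallest k (fun s => ⨅ i, keepSmallest k (z i) s) =
      keepSmallest k (fun s => ⨅ i, z i s) := by
  apply keepSmallest_eq_of_agree
  · intro r; exact iInf_mono (fun i => le_keepSmallest)
  · intro r hr
    apply le_antisymm _ (iInf_mono (fun i => le_keepSmallest))
    -- The vector attaining the minimum at `r` dominates the merged vector and agrees with it at
    -- `r`, so `r` has no larger rank there and survives the selection.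
    obtain ⟨i, hi⟩ := ciInf_mem (fun i => z i r)
    refine (iInf_le _ i).trans ?_
    rw [keepSmallest_of_lt]
    · exact hi.le
    · refine lt_of_le_of_lt (rankOf_le_of_le (x := fun s => ⨅ i, z i s) ?_ hi) hr
      intro t; exact iInf_le _ i

end KeepSmallest

/-! ### Truncated values and their encoding -/

open Classical in
/-- Replace the values that are at least `M` by `⊤`. -/
noncomputable def truncAt (M : ℕ) (x : ℕ∞) : ℕ∞ := if x < M then x else ⊤

theorem le_truncAt (M : ℕ) (x : ℕ∞) : x ≤ truncAt M x := by
  unfold truncAt; split_ifs <;> simp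

theorem truncAt_of_lt {M : ℕ} {x : ℕ∞} (h : x < M) : truncAt M x = x := if_pos h

theorem truncAt_top (M : ℕ) : truncAt M ⊤ = ⊤ := by simp [truncAt]

theorem truncAt_mono (M : ℕ) : Monotone (truncAt M) := by
  intro x y h
  by_cases hy : y < M
  · rw [truncAt_of_lt hy, truncAt_of_lt (h.trans_lt hy)]; exact h
  · rw [show truncAt M y = ⊤ from if_neg hy]; exact le_top

theorem truncAt_iInf {ι : Type} [Nonempty ι] (M : ℕ) (z : ι → ℕ∞) :
    truncAt M (⨅ i, z i) = ⨅ i, truncAt M (z i) := by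
  apply le_antisymm
  · exact le_iInf fun i => truncAt_mono M (iInf_le _ i)
  · obtain ⟨i, hi⟩ := ciInf_mem z
    rw [← hi]; exact iInf_le _ i

/-- A symbol of a message: a node together with a truncated value. -/
abbrev Entry (n M : ℕ) : Type := Fin n × Option (Fin M)

open Classical in
/-- The code of a truncated value. -/
noncomputable def encodeValue (M : ℕ) (x : ℕ∞) : Option (Fin M) :=
  if h : x.toNat < M ∧ x ≠ ⊤ then some ⟨x.toNat, h.1⟩ else none

/-- The value with a given code. -/
noncomputable def decodeValue {M : ℕ} : Option (Fin M) → ℕ∞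
  | some i => (i.1 : ℕ∞)
  | none => ⊤

theorem decodeValue_encodeValue (M : ℕ) (x : ℕ∞) :
    decodeValue (encodeValue M x) = truncAt M x := by
  induction x using ENat.recTopCoe with
  | top => simp [encodeValue, truncAt, decodeValue]
  | coe a =>
    by_cases h : a < M <;> simp [encodeValue, truncAt, decodeValue, h]

/-- The vector described by a family of symbols. -/
noncomputable def unpackVec {n M : ℕ} {ι : Type} (e : ι → Entry n M) (s : Fin n) : ℕ∞ :=
  ⨅ i, ⨅ _ : (e i).1 = s, decodeValue (e i).2

/-- Slot `p` carries the entry of rank `p`. If `k > n`, the surplus slots hold the value `⊤` at node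
0, which does not affect the infimum. -/
theorem exists_packVec (n M k : ℕ) [NeZero n] :
    ∃ pack : (Fin n → ℕ∞) → Fin k → Entry n M,
      ∀ x, unpackVec (pack x) = keepSmallest k (fun s => truncAt M (x s)) := by
  classical
  suffices h : ∀ x : Fin n → ℕ∞, ∃ e : Fin k → Entry n M,
      unpackVec e = keepSmallest k (fun s => truncAt M (x s)) from
    ⟨fun x => (h x).choose, fun x => (h x).choose_spec⟩
  intro x
  set y := fun s => truncAt M (x s) with hy
  obtain ⟨e, he, he'⟩ : ∃ e : Fin k → Entry n M,
      (∀ p s, rankOf y s = p.1 → e p = (s, encodeValue M (x s))) ∧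
      (∀ p, (∀ s, rankOf y s ≠ p.1) → e p = (0, none)) := by
    refine ⟨fun p => if h : ∃ s, rankOf y s = p.1 then (h.choose, encodeValue M (x h.choose))
      else (0, none), fun p s hs => ?_, fun p hp => dif_neg (by simpa using hp)⟩
    have h : ∃ s, rankOf y s = p.1 := ⟨s, hs⟩
    beta_reduce
    rw [dif_pos h, rankOf_injective y (h.choose_spec.trans hs.symm)]
  refine ⟨e, ?_⟩
  funext s
  apply le_antisymm
  · by_cases hs : rankOf y s < k
    · refine iInf₂_le_of_le (⟨rankOf y s, hs⟩ : Fin k) ?_ ?_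
      · rw [he ⟨_, hs⟩ s rfl]
      · rw [he ⟨_, hs⟩ s rfl, keepSmallest_of_lt hs, decodeValue_encodeValue]
    · rw [keepSmallest, if_neg hs]; exact le_top
  · refine le_iInf₂ fun p hp => ?_
    by_cases h : ∃ s, rankOf y s = p.1
    · obtain ⟨r, hr⟩ := h
      rw [he p r hr] at hp ⊢
      obtain rfl : r = s := hp
      rw [keepSmallest_of_lt (hr ▸ p.2), decodeValue_encodeValue]
    · rw [he' p (by simpa using h)]; exact le_top

/-! ### The filtered min-plus product on the clique -/

/-- The min-plus product of `A` and `X`, where only the `k` smallest entries of every row of `X`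
and of the product are kept, and values from `M` on are replaced by `⊤`. -/
noncomputable def filteredProduct {n : ℕ} (M k : ℕ) (A X : Fin n → Fin n → ℕ∞) (v : Fin n) :
    Fin n → ℕ∞ :=
  keepSmallest k fun s => truncAt M
    (⨅ u, truncAt M (A v u) + keepSmallest k (fun r => truncAt M (X u r)) s)

/-- The number of rounds of a filtered product in which `⌈√n⌉ * t` entries per row are kept. -/
def productRounds (t : ℕ) : ℕ := 2 * 16 + 2 * (16 * t) + 2 * (16 * t)

/-- The work is cut into `q * q` cells. Cell (I, J) receives the entries of `A` with row block I and
column block J, and the packed rows of `X` in block J; it returns one packed partial row to each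
node of block I. That partial rows may be filtered before they are merged is
`keepSmallest_iInf_keepSmallest`. -/
theorem realizes_filteredProduct {n B M q : ℕ} (hn : 0 < n) (hq : n ≤ q * q) (hq' : q * q ≤ 4 * n)
    (hB : Fintype.card (Entry n M) ≤ 2 ^ B) (t : ℕ) :
    Realizes n B (productRounds t)
      (fun (x : Fin n → (Fin n → ℕ∞) × (Fin n → ℕ∞)) =>
        filteredProduct M (q * t) (fun v => (x v).1) (fun v => (x v).2)) := by
  classical
  have hq0 : 0 < q := Nat.pos_of_ne_zero (by rintro rfl; simp at hq; omega)
  have : NeZero n := ⟨hn.ne'⟩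
  have : NeZero q := ⟨hq0.ne'⟩
  -- Each node simulates at most four cells, since `q * q ≤ 4 * n`; a pair of nodes thus hosts at
  -- most 16 pairs of cells.
  obtain ⟨fold⟩ : Nonempty (Fin q × Fin q ↪ Fin n × Fin 4) :=
    Function.Embedding.nonempty_of_card_le (by simp; linarith)
  obtain ⟨coord⟩ : Nonempty (Fin n ↪ Fin q × Fin q) :=
    Function.Embedding.nonempty_of_card_le (by simpa using hq)
  obtain ⟨pack, hpack⟩ := exists_packVec n M (q * t)
  let φ : Fin q × Fin q → Fin n := fun z => (fold z).1
  let lay : Fin q × Fin q → Fin 4 := fun z => (fold z).2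
  have hφ : ∀ z w, φ z = φ w → lay z = lay w → z = w :=
    fun z w h1 h2 => fold.injective (Prod.ext h1 h2)
  let hi : Fin n → Fin q := fun i => (coord i).1
  let lo : Fin n → Fin q := fun i => (coord i).2
  have hcoord : ∀ i j, hi i = hi j → lo i = lo j → i = j :=
    fun i j h1 h2 => coord.injective (Prod.ext h1 h2)
  let e₁ : Fin 4 × Fin 4 ≃ Fin 16 := Fintype.equivFinOfCardEq (by simp)
  let e₂ : (Fin 4 × Fin 4) × Fin t ≃ Fin (16 * t) := Fintype.equivFinOfCardEq (by simp)
  let pos : Fin (q * t) ≃ Fin q × Fin t := finProdFinEquiv.symm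
  -- The shift by `lo` of the row balances both hops: for a fixed source the intermediate cell
  -- determines the column, and the intermediate and target cells together determine row and column.
  obtain ⟨gA, hgA, hgA'⟩ := Realizes.route (n := n) (B := B)
    (α := (Fin n → ℕ∞) × (Fin n → ℕ∞)) (K := Fin n × Fin n) hB
    (fun k => k.1) (fun k => φ (hi k.2 + lo k.1, lo k.2)) (fun k => φ (hi k.1, hi k.2))
    (fun k => e₁ (lay (hi k.2 + lo k.1, lo k.2), 0))
    (fun k => e₁ (lay (hi k.2 + lo k.1, lo k.2), lay (hi k.1, hi k.2)))
    (by
      rintro ⟨i, j⟩ ⟨i', j'⟩ h1 h2 h3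
      simp only [EmbeddingLike.apply_eq_iff_eq, Prod.mk.injEq, and_true] at h1 h2 h3
      subst h1
      have := hφ _ _ h2 h3
      simp only [Prod.mk.injEq, add_left_inj] at this
      rw [hcoord j j' this.1 this.2])
    (by
      rintro ⟨i, j⟩ ⟨i', j'⟩ h1 h2 h3
      simp only [EmbeddingLike.apply_eq_iff_eq, Prod.mk.injEq] at h1 h2 h3
      have a1 := hφ _ _ h1 h3.1
      have a2 := hφ _ _ h2 h3.2
      simp only [Prod.mk.injEq] at a1 a2
      obtain rfl := hcoord j j' a2.2 a1.2
      rw [hcoord i i' a2.1 (add_left_cancel a1.1)])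
    (fun _ x k => (0, encodeValue M (x.1 k.2)))
  -- A row of `X` is copied to every block I. A slot number is split by `pos` into a coordinate in
  -- `Fin q`, which spreads the load, and one in `Fin t`, which is the congestion.
  obtain ⟨gX, hgX, hgX'⟩ := Realizes.route (n := n) (B := B)
    (α := (Fin n → ℕ∞) × (Fin n → ℕ∞)) (K := Fin n × Fin q × Fin (q * t)) hB
    (fun k => k.1) (fun k => φ ((pos k.2.2).1, k.2.1 + lo k.1)) (fun k => φ (k.2.1, hi k.1))
    (fun k => e₂ ((lay ((pos k.2.2).1, k.2.1 + lo k.1), 0), (pos k.2.2).2))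
    (fun k => e₂ ((lay ((pos k.2.2).1, k.2.1 + lo k.1), lay (k.2.1, hi k.1)), (pos k.2.2).2))
    (by
      rintro ⟨j, I, p⟩ ⟨j', I', p'⟩ h1 h2 h3
      simp only [EmbeddingLike.apply_eq_iff_eq, Prod.mk.injEq, and_true] at h1 h2 h3
      subst h1
      have := hφ _ _ h2 h3.1
      simp only [Prod.mk.injEq, add_left_inj] at this
      obtain rfl : p = p' := pos.injective (Prod.ext this.1 h3.2)
      rw [this.2])
    (by
      rintro ⟨j, I, p⟩ ⟨j', I', p'⟩ h1 h2 h3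
      simp only [EmbeddingLike.apply_eq_iff_eq, Prod.mk.injEq] at h1 h2 h3
      have a1 := hφ _ _ h1 h3.1.1
      have a2 := hφ _ _ h2 h3.1.2
      simp only [Prod.mk.injEq] at a1 a2
      obtain rfl : p = p' := pos.injective (Prod.ext a1.1 h3.2)
      obtain rfl := a2.1
      rw [hcoord j j' a2.2 (add_left_cancel a1.2)])
    (fun _ x k => pack x.2 k.2.2)
  -- The partial rows travel back along the same kind of route in the reverse direction.
  obtain ⟨gY, hgY, hgY'⟩ := Realizes.route (n := n) (B := B)
    (α := (Fin n × Fin n → Entry n M) × (Fin n × Fin q × Fin (q * t) → Entry n M))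
    (K := Fin n × Fin q × Fin (q * t)) hB
    (fun k => φ (hi k.1, k.2.1)) (fun k => φ ((pos k.2.2).1, k.2.1 + lo k.1)) (fun k => k.1)
    (fun k => e₂ ((lay ((pos k.2.2).1, k.2.1 + lo k.1), lay (hi k.1, k.2.1)), (pos k.2.2).2))
    (fun k => e₂ ((lay ((pos k.2.2).1, k.2.1 + lo k.1), 0), (pos k.2.2).2))
    (by
      rintro ⟨j, I, p⟩ ⟨j', I', p'⟩ h2 h1 h3
      simp only [EmbeddingLike.apply_eq_iff_eq, Prod.mk.injEq] at h1 h2 h3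
      have a1 := hφ _ _ h1 h3.1.1
      have a2 := hφ _ _ h2 h3.1.2
      simp only [Prod.mk.injEq] at a1 a2
      obtain rfl : p = p' := pos.injective (Prod.ext a1.1 h3.2)
      obtain rfl := a2.2
      rw [hcoord j j' a2.1 (add_left_cancel a1.2)])
    (by
      rintro ⟨j, I, p⟩ ⟨j', I', p'⟩ h2 h1 h3
      simp only [EmbeddingLike.apply_eq_iff_eq, Prod.mk.injEq, and_true] at h1 h2 h3
      subst h1
      have := hφ _ _ h2 h3.1
      simp only [Prod.mk.injEq, add_left_inj] at this
      obtain rfl : p = p' := pos.injective (Prod.ext this.1 h3.2)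
      rw [this.2])
    (fun _ x k => pack (fun s => ⨅ j, ⨅ _ : hi j = k.2.1, decodeValue (x.1 (k.1, j)).2 +
      unpackVec (fun p => x.2 (j, hi k.1, p)) s) k.2.2)
  have S₁ := hgA.withLocal (fun _ x => x) (fun _ x y => (x, y))
  have S₂ := hgX.withLocal (fun _ (x : ((Fin n → ℕ∞) × (Fin n → ℕ∞)) ×
      (Fin n × Fin n → Entry n M)) => x.1)
    (fun _ x y => (x.2, y))
  have S₃ := hgY.withLocal (fun _ x => x) (fun v _ y => keepSmallest (q * t)
    (fun s => ⨅ J : Fin q, unpackVec (fun p => y (v, J, p)) s))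
  have S := S₃.comp (S₂.comp S₁)
  unfold productRounds
  convert S using 1
  funext x v
  simp only [hgY' _ (_, _, _)]
  simp only [hpack, keepSmallest_iInf_keepSmallest]
  unfold filteredProduct
  congr 1
  funext s
  rw [← truncAt_iInf]
  congr 1
  have term : ∀ j, decodeValue (gA x (φ (hi v, hi j)) (v, j)).2 +
      unpackVec (fun p => gX x (φ (hi v, hi j)) (j, hi v, p)) s =
      truncAt M ((x v).1 j) + keepSmallest (q * t) (fun r => truncAt M ((x j).2 r)) s := by
    intro j
    rw [hgA' x (v, j)]
    simp only [hgX' x (j, hi v, _)]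
    rw [← hpack, decodeValue_encodeValue]
  apply le_antisymm
  · refine le_iInf fun J => le_iInf₂ fun j hj => ?_
    subst hj
    rw [term]
    exact iInf_le _ j
  · refine le_iInf fun j => ?_
    refine iInf_le_of_le (hi j) (iInf₂_le_of_le j rfl ?_)
    rw [term]

/-! ### Hop-bounded distances -/

open Classical in
/-- The least weight of a path from `v` to `s` with exactly `i` steps, where `B v u` is the
weight of the step from `v` to `u`. -/
noncomputable def hopDist {n : ℕ} (B : Fin n → Fin n → ℕ∞) : ℕ → Fin n → Fin n → ℕ∞
  | 0 => fun v s => if v = s then 0 else ⊤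
  | i + 1 => fun v s => ⨅ u, B v u + hopDist B i u s

section HopDist

variable {n : ℕ} {B : Fin n → Fin n → ℕ∞}

theorem exists_hopDist_succ (B : Fin n → Fin n → ℕ∞) (i : ℕ) (v s : Fin n) :
    ∃ u, B v u + hopDist B i u s = hopDist B (i + 1) v s :=
  have : Nonempty (Fin n) := ⟨v⟩
  ciInf_mem (fun u => B v u + hopDist B i u s)

theorem hopDist_succ_le (i : ℕ) (v u s : Fin n) :
    hopDist B (i + 1) v s ≤ B v u + hopDist B i u s := iInf_le _ u

theorem hopDist_zero_self (v : Fin n) : hopDist B 0 v v = 0 := if_pos rfl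

theorem hopDist_one_le (v s : Fin n) : hopDist B 1 v s ≤ B v s := by
  simpa [hopDist_zero_self] using hopDist_succ_le (B := B) 0 v s s

theorem le_hopDist_one (v s : Fin n) : B v s ≤ hopDist B 1 v s := by
  refine le_iInf fun u => ?_
  by_cases h : u = s
  · subst h; exact le_self_add
  · simp [hopDist, h]

theorem hopDist_add_le (i j : ℕ) (v u s : Fin n) :
    hopDist B (i + j) v s ≤ hopDist B i v u + hopDist B j u s := by
  induction i generalizing v with
  | zero =>
    by_cases h : v = u
    · subst h; simp [hopDist_zero_self]
    · simp [hopDist, h]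
  | succ i ih =>
    obtain ⟨w, hw⟩ := exists_hopDist_succ B i v u
    rw [Nat.add_right_comm, ← hw, add_assoc (B v w)]
    exact (hopDist_succ_le _ v w s).trans (add_le_add_right (ih w) _)

theorem exists_hopDist_add (i j : ℕ) (v s : Fin n) :
    ∃ u, hopDist B i v u + hopDist B j u s ≤ hopDist B (i + j) v s := by
  induction i generalizing v with
  | zero => exact ⟨v, by simp [hopDist_zero_self]⟩
  | succ i ih =>
    rw [Nat.add_right_comm]
    obtain ⟨w, hw⟩ := exists_hopDist_succ B (i + j) v s
    obtain ⟨u, hu⟩ := ih w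
    refine ⟨u, ?_⟩
    rw [← hw]
    refine (add_le_add_left (hopDist_succ_le i v w u) _).trans ?_
    rw [add_assoc]
    exact add_le_add_right hu _

theorem hopDist_self (hB : ∀ v, B v v = 0) (i : ℕ) (v : Fin n) : hopDist B i v v = 0 := by
  induction i with
  | zero => exact hopDist_zero_self v
  | succ i ih =>
    have := hopDist_succ_le (B := B) i v v v
    rw [hB, ih] at this
    simpa using this

theorem hopDist_le_of_le (hB : ∀ v, B v v = 0) {i j : ℕ} (h : i ≤ j) (v s : Fin n) :
    hopDist B j v s ≤ hopDist B i v s := by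
  obtain ⟨k, rfl⟩ := Nat.exists_eq_add_of_le h
  have := hopDist_add_le (B := B) i k v s s
  rwa [hopDist_self hB, add_zero] at this

/-- Allows a path to be explored from its far end although the step matrix need not be symmetric. -/
theorem hopDist_transpose_le (i : ℕ) (x y : Fin n) :
    hopDist (fun v u => B u v) i y x ≤ hopDist B i x y := by
  induction i generalizing x with
  | zero => simp [hopDist, eq_comm]
  | succ i ih =>
    obtain ⟨w, hw⟩ := exists_hopDist_succ B i x y
    rw [← hw, add_comm (B x w)]
    exact (hopDist_add_le i 1 y w x).trans (add_le_add (ih w) (hopDist_one_le w x))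

/-- `d` is the shortest-path metric of the symmetric weight matrix `W`. -/
structure IsPathMetric (W d : Fin n → Fin n → ℕ∞) : Prop where
  weight_self : ∀ v, W v v = 0
  weight_symm : ∀ v u, W v u = W u v
  self : ∀ v, d v v = 0
  symm : ∀ v u, d v u = d u v
  triangle : ∀ v u s, d v s ≤ d v u + d u s
  eq_of_zero : ∀ v u, d v u = 0 → v = u
  le_weight : ∀ v u, d v u ≤ W v u
  hopDist_le : ∀ v u, hopDist W n v u ≤ d v u

variable {W d : Fin n → Fin n → ℕ∞}

theorem IsPathMetric.le_hopDist (hd : IsPathMetric W d) (hB : ∀ v u, d v u ≤ B v u) (i : ℕ)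
    (v s : Fin n) : d v s ≤ hopDist B i v s := by
  induction i generalizing v with
  | zero =>
    by_cases h : v = s
    · subst h; simp [hd.self]
    · simp [hopDist, h]
  | succ i ih => exact le_iInf fun u => (hd.triangle v u s).trans (add_le_add (hB v u) (ih u))

theorem IsPathMetric.hopDist_eq (hd : IsPathMetric W d) {i : ℕ} (hi : n ≤ i) (v s : Fin n) :
    hopDist W i v s = d v s :=
  le_antisymm ((hopDist_le_of_le hd.weight_self hi v s).trans (hd.hopDist_le v s))
    (hd.le_hopDist hd.le_weight i v s)

/-- Recurrent device: if two lower bounds are attained in sum and the sum is finite, each is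
attained. It shows that both parts of a shortest path are shortest paths. -/
theorem ENat.eq_and_eq_of_add_le {a b a' b' : ℕ∞} (ha : a ≤ a') (hb : b ≤ b')
    (h : a' + b' ≤ a + b) (htop : a + b ≠ ⊤) : a' = a ∧ b' = b := by
  have h' : a' + b' ≠ ⊤ := ne_top_of_le_ne_top htop h
  replace htop : a ≠ ⊤ ∧ b ≠ ⊤ := by simpa using htop
  replace h' : a' ≠ ⊤ ∧ b' ≠ ⊤ := by simpa using h'
  lift a to ℕ using htop.1
  lift b to ℕ using htop.2
  lift a' to ℕ using h'.1
  lift b' to ℕ using h'.2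
  norm_cast at *
  omega

/-- A shortest path from a node with a property to a node without it crosses an edge at which
the property is lost. -/
theorem IsPathMetric.exists_crossing (hd : IsPathMetric W d) (P : Fin n → Prop) {x y : Fin n}
    (hx : P x) (hy : ¬ P y) (hxy : d x y ≠ ⊤) :
    ∃ z z', P z ∧ ¬ P z' ∧ d x z + W z z' + d z' y = d x y ∧ d x z + W z z' = d x z' := by
  have main : ∀ i x, P x → d x y ≠ ⊤ → hopDist W i x y = d x y →
      ∃ z z', P z ∧ ¬ P z' ∧ d x z + W z z' + d z' y ≤ d x y := by
    intro i
    induction i with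
    | zero =>
      intro x hx hxy h
      by_cases hxy' : x = y
      · exact absurd (hxy' ▸ hx) hy
      · simp [hopDist, hxy'] at h; exact absurd h.symm hxy
    | succ i ih =>
      intro x hx hxy h
      obtain ⟨w, hw⟩ := exists_hopDist_succ W i x y
      have hle : W x w + hopDist W i w y ≤ d x w + d w y := by
        rw [hw, h]; exact hd.triangle x w y
      have hle' : d x w + d w y ≤ d x y := by
        rw [← h, ← hw]
        exact add_le_add (hd.le_weight x w) (hd.le_hopDist hd.le_weight i w y)
      obtain ⟨e1, e2⟩ := ENat.eq_and_eq_of_add_le (hd.le_weight x w)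
        (hd.le_hopDist hd.le_weight i w y) hle (ne_top_of_le_ne_top hxy hle')
      by_cases hPw : P w
      · obtain ⟨z, z', hz, hz', hzz⟩ := ih w hPw
          (ne_top_of_le_ne_top hxy (le_add_self.trans hle')) e2
        refine ⟨z, z', hz, hz', le_trans ?_ hle'⟩
        refine le_trans ?_ (add_le_add_right hzz (d x w))
        rw [add_assoc, add_assoc, ← add_assoc (d x w)]
        exact add_le_add_left (hd.triangle x w z) _
      · refine ⟨x, w, hx, hPw, ?_⟩
        rw [hd.self, zero_add, e1]; exact hle'
  obtain ⟨z, z', hz, hz', h⟩ := main n x hx hxy (hd.hopDist_eq le_rfl x y)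
  have h1 : d x z' ≤ d x z + W z z' :=
    (hd.triangle x z z').trans (add_le_add_right (hd.le_weight z z') _)
  have h2 : d x z' + d z' y ≤ d x y := (add_le_add_left h1 _).trans h
  obtain ⟨e1, -⟩ := ENat.eq_and_eq_of_add_le h1 (le_refl (d z' y))
    (h.trans (hd.triangle x z' y)) (ne_top_of_le_ne_top hxy h2)
  exact ⟨z, z', hz, hz', le_antisymm h (by rw [e1]; exact hd.triangle x z' y), e1⟩

end HopDist

/-! ### Nearest nodes -/

section Nearest

variable {n M k : ℕ} {W d R : Fin n → Fin n → ℕ∞}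

theorem IsPathMetric.le_filteredProduct (hd : IsPathMetric W d) {A X : Fin n → Fin n → ℕ∞}
    (hA : ∀ v u, d v u ≤ A v u) (hX : ∀ v u, d v u ≤ X v u) (v s : Fin n) :
    d v s ≤ filteredProduct M k A X v s := by
  refine le_trans (le_trans (le_iInf fun u => ?_) (le_truncAt M _)) le_keepSmallest
  refine (hd.triangle v u s).trans (add_le_add ((hA v u).trans (le_truncAt M _)) ?_)
  exact ((hX u s).trans (le_truncAt M _)).trans
    (le_keepSmallest (x := fun r => truncAt M (X u r)))

/-- The matrix of (estimated) distances to the `k` nearest nodes, by repeated squaring. -/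
noncomputable def nearest (M k T : ℕ) (R : Fin n → Fin n → ℕ∞) : Fin n → Fin n → ℕ∞ :=
  (fun N => filteredProduct M k N N)^[T] R

theorem IsPathMetric.le_nearest (hd : IsPathMetric W d) (hR : ∀ v u, d v u ≤ R v u) (T : ℕ)
    (v u : Fin n) : d v u ≤ nearest M k T R v u := by
  induction T generalizing v u with
  | zero => exact hR v u
  | succ T ih =>
    rw [nearest, Function.iterate_succ_apply']
    exact hd.le_filteredProduct ih ih v u

/-- If `u` lies on a shortest path, whatever precedes `s` seen from `u` also precedes `s` seen from
`v`, by the triangle inequality. Breaking ties by the same index order at all nodes makes this work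
in the case of equality. -/
theorem IsPathMetric.rankOf_le_of_mem_path (hd : IsPathMetric W d) {v u s : Fin n}
    (h : d v u + d u s ≤ d v s) (hfin : d v s ≠ ⊤) :
    rankOf (d v) u ≤ rankOf (d v) s ∧ rankOf (d u) s ≤ rankOf (d v) s := by
  have hvu : d v u ≠ ⊤ := ne_top_of_le_ne_top hfin (le_self_add.trans h)
  have hus : d u s ≠ ⊤ := ne_top_of_le_ne_top hfin (le_add_self.trans h)
  constructor
  · rcases eq_or_ne u s with rfl | hne
    · exact le_rfl
    · refine (rankOf_lt_rankOf (Or.inl (lt_of_lt_of_le ?_ h))).le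
      have : d u s ≠ 0 := fun h0 => hne (hd.eq_of_zero _ _ h0)
      simpa using (ENat.add_lt_add_iff_left hvu).2 (pos_iff_ne_zero.2 this)
  · apply rankOf_le_rankOf
    rintro r (hr | ⟨hr, hr'⟩)
    · refine Or.inl (lt_of_le_of_lt (hd.triangle v u r) (lt_of_lt_of_le ?_ h))
      exact (ENat.add_lt_add_iff_left hvu).2 hr
    · have : d v r ≤ d v s := (hd.triangle v u r).trans (by rw [hr]; exact h)
      rcases this.lt_or_eq with h1 | h1
      · exact Or.inl h1
      · exact Or.inr ⟨h1, hr'⟩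

/-- A shortest path with at most 2^(T+1) hops is cut into halves of at most 2^T hops. By
`rankOf_le_of_mem_path` both halves concern near pairs, so filtering has not discarded their values.
`R` is only required to lie between `d` and `W`, because the query works with a matrix that already
contains hopset edges. -/
theorem IsPathMetric.nearest_eq (hd : IsPathMetric W d) (hM : ∀ v u, d v u ≠ ⊤ → d v u < M)
    (hdR : ∀ v u, d v u ≤ R v u) (hRW : ∀ v u, R v u ≤ W v u) (T : ℕ) (v s : Fin n)
    (hs : rankOf (d v) s < k) (hhop : hopDist W (2 ^ T) v s = d v s) :
    nearest M k T R v s = d v s := by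
  induction T generalizing v s with
  | zero =>
    refine le_antisymm ((hRW v s).trans ?_) (hdR v s)
    exact (le_hopDist_one v s).trans hhop.le
  | succ T ih =>
    refine le_antisymm ?_ (hd.le_nearest hdR _ v s)
    by_cases hfin : d v s = ⊤
    · rw [hfin]; exact le_top
    obtain ⟨u, hu⟩ := exists_hopDist_add (B := W) (2 ^ T) (2 ^ T) v s
    rw [← two_mul, ← pow_succ', hhop] at hu
    have l1 := hd.le_hopDist hd.le_weight (2 ^ T) v u
    have l2 := hd.le_hopDist hd.le_weight (2 ^ T) u s
    have hle := (add_le_add l1 l2).trans hu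
    obtain ⟨e1, e2⟩ := ENat.eq_and_eq_of_add_le l1 l2 (hu.trans (hd.triangle v u s))
      (ne_top_of_le_ne_top hfin hle)
    obtain ⟨r1, r2⟩ := hd.rankOf_le_of_mem_path hle hfin
    have i1 := ih v u (r1.trans_lt hs) e1
    have i2 := ih u s (r2.trans_lt hs) e2
    have m1 := hM v u (ne_top_of_le_ne_top hfin (le_self_add.trans hle))
    have m2 := hM u s (ne_top_of_le_ne_top hfin (le_add_self.trans hle))
    set N := nearest M k T R with hN
    have hdN : ∀ v u, d v u ≤ N v u := hd.le_nearest hdR T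
    rw [nearest, Function.iterate_succ_apply']
    change filteredProduct M k N N v s ≤ d v s
    have inner : keepSmallest k (fun r => truncAt M (N u r)) s = d u s := by
      have e : truncAt M (N u s) = d u s := by rw [i2, truncAt_of_lt m2]
      rw [keepSmallest_of_lt, e]
      exact (rankOf_le_of_le (x := d u) (y := fun r => truncAt M (N u r))
        (fun r => (hdN u r).trans (le_truncAt M _)) e).trans_lt (r2.trans_lt hs)
    have outer : truncAt M (⨅ w, truncAt M (N v w) +
        keepSmallest k (fun r => truncAt M (N w r)) s) = d v s := by
      have h1 : (⨅ w, truncAt M (N v w) +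
          keepSmallest k (fun r => truncAt M (N w r)) s) ≤ d v s := by
        refine (iInf_le _ u).trans ?_
        rw [inner, i1, truncAt_of_lt m1]; exact hle
      rw [truncAt_of_lt (h1.trans_lt (hM v s hfin))]
      refine le_antisymm h1 (le_iInf fun w => (hd.triangle v w s).trans (add_le_add ?_ ?_))
      · exact (hdN v w).trans (le_truncAt M _)
      · exact ((hdN w s).trans (le_truncAt M _)).trans
          (le_keepSmallest (x := fun r => truncAt M (N w r)))
    unfold filteredProduct
    rw [keepSmallest_of_lt, outer]
    refine lt_of_le_of_lt (rankOf_le_of_le (x := d v) (fun r => ?_) outer) hs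
    refine le_trans (le_iInf fun w => ?_) (le_truncAt M _)
    refine (hd.triangle v w r).trans (add_le_add ((hdN v w).trans (le_truncAt M _)) ?_)
    exact ((hdN w r).trans (le_truncAt M _)).trans
      (le_keepSmallest (x := fun r => truncAt M (N w r)))

/-- The matrix `R` with shortcuts between all pairs one of which is near to the other. -/
noncomputable def withShortcuts (M k T : ℕ) (R : Fin n → Fin n → ℕ∞) (v u : Fin n) : ℕ∞ :=
  min (R v u) (min (nearest M k T R v u) (truncAt M (nearest M k T R u v)))

theorem IsPathMetric.le_withShortcuts (hd : IsPathMetric W d) (hR : ∀ v u, d v u ≤ R v u) (T : ℕ)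
    (v u : Fin n) : d v u ≤ withShortcuts M k T R v u := by
  refine le_min (hR v u) (le_min (hd.le_nearest hR T v u) ?_)
  rw [hd.symm]
  exact (hd.le_nearest hR T u v).trans (le_truncAt M _)

theorem withShortcuts_le (T : ℕ) (v u : Fin n) : withShortcuts M k T R v u ≤ R v u :=
  min_le_left _ _

theorem IsPathMetric.withShortcuts_le_of_near (hd : IsPathMetric W d)
    (hM : ∀ v u, d v u ≠ ⊤ → d v u < M)
    (hdR : ∀ v u, d v u ≤ R v u) (hRW : ∀ v u, R v u ≤ W v u) {T : ℕ} (hT : n ≤ 2 ^ T)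
    {v u : Fin n} (h : rankOf (d v) u < k ∨ rankOf (d u) v < k) :
    withShortcuts M k T R v u ≤ d v u := by
  by_cases hfin : d v u = ⊤
  · rw [hfin]; exact le_top
  rcases h with h | h
  · refine (min_le_right _ _).trans ((min_le_left _ _).trans ?_)
    exact (hd.nearest_eq hM hdR hRW T v u h (hd.hopDist_eq hT v u)).le
  · refine (min_le_right _ _).trans ((min_le_right _ _).trans ?_)
    rw [hd.nearest_eq hM hdR hRW T u v h (hd.hopDist_eq hT u v), hd.symm u v,
      truncAt_of_lt (hM v u hfin)]

end Nearest

/-! ### Distances from a set of sources -/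

section Sources

variable {n M k : ℕ} {B : Fin n → Fin n → ℕ∞}

open Classical in
/-- The initial distance estimates: every source knows its distance to itself. -/
noncomputable def sourceMatrix (S : Finset (Fin n)) (v s : Fin n) : ℕ∞ :=
  if v = s ∧ s ∈ S then 0 else ⊤

/-- The distance estimates after `h` rounds of relaxation along `B`. -/
noncomputable def relax (M k h : ℕ) (B : Fin n → Fin n → ℕ∞) (S : Finset (Fin n)) :
    Fin n → Fin n → ℕ∞ :=
  (filteredProduct M k B)^[h] (sourceMatrix S)

theorem relax_eq_top {S : Finset (Fin n)} (h : ℕ) (v : Fin n) {s : Fin n} (hs : s ∉ S) :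
    relax M k h B S v s = ⊤ := by
  induction h generalizing v with
  | zero => simp [relax, sourceMatrix, hs]
  | succ h ih =>
    rw [relax, Function.iterate_succ_apply']
    change filteredProduct M k B (relax M k h B S) v s = ⊤
    refine top_le_iff.1 (le_trans ?_ (le_trans (le_truncAt M _) le_keepSmallest))
    refine le_iInf fun u => ?_
    have : ⊤ ≤ keepSmallest k (fun r => truncAt M (relax M k h B S u r)) s := by
      refine le_trans ?_ le_keepSmallest
      simp [ih u, truncAt_top]
    rw [top_le_iff.1 this]; simp

/-- Only the columns in `S` are ever finite, and there are at most `k` of them, so the filter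
removes nothing; values below `M` also survive truncation. -/
theorem relax_le_hopDist {S : Finset (Fin n)} (hS : S.card ≤ k) (h : ℕ) (v : Fin n) {s : Fin n}
    (hs : s ∈ S) (hlt : hopDist B h v s < M) : relax M k h B S v s ≤ hopDist B h v s := by
  induction h generalizing v with
  | zero =>
    by_cases hvs : v = s
    · simp [relax, sourceMatrix, hvs, hs]
    · simp [hopDist, hvs]
  | succ h ih =>
    obtain ⟨u, hu⟩ := exists_hopDist_succ B h v s
    rw [← hu] at hlt ⊢
    have l1 : B v u < M := le_self_add.trans_lt hlt
    have l2 : hopDist B h u s < M := le_add_self.trans_lt hlt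
    have i := ih u l2
    rw [relax, Function.iterate_succ_apply']
    change filteredProduct M k B (relax M k h B S) v s ≤ _
    unfold filteredProduct
    have e1 : ∀ w, keepSmallest k (fun r => truncAt M (relax M k h B S w r)) =
        fun r => truncAt M (relax M k h B S w r) := fun w =>
      keepSmallest_eq_self S hS (fun r hr => by rw [relax_eq_top h w hr, truncAt_top])
    simp only [e1]
    rw [keepSmallest_eq_self S hS]
    · have hle : (⨅ w, truncAt M (B v w) + truncAt M (relax M k h B S w s)) ≤
          B v u + hopDist B h u s := by
        refine (iInf_le _ u).trans ?_
        rw [truncAt_of_lt l1, truncAt_of_lt (i.trans_lt l2)]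
        exact add_le_add_right i _
      rw [truncAt_of_lt (hle.trans_lt hlt)]
      exact hle
    · intro r hr
      have : ∀ w, truncAt M (B v w) + truncAt M (relax M k h B S w r) = ⊤ := fun w => by
        rw [relax_eq_top h w hr, truncAt_top]; simp
      simp [this, truncAt_top]

theorem IsPathMetric.le_relax {W d : Fin n → Fin n → ℕ∞} (hd : IsPathMetric W d)
    (hB : ∀ v u, d v u ≤ B v u) (S : Finset (Fin n)) (h : ℕ) (v s : Fin n) :
    d v s ≤ relax M k h B S v s := by
  induction h generalizing v s with
  | zero =>
    by_cases hvs : v = s ∧ s ∈ S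
    · simp [relax, sourceMatrix, hvs, hd.self]
    · simp [relax, sourceMatrix, hvs]
  | succ h ih =>
    rw [relax, Function.iterate_succ_apply']
    exact hd.le_filteredProduct hB ih v s

end Sources

/-! ### Paths with few hops through the pivots -/

section Hopset

variable {n k : ℕ} {W d B : Fin n → Fin n → ℕ∞} {A : Finset (Fin n)}

/-- Every node has an element of `A` among its `k` nearest nodes, unless these are all nodes. -/
def HitsNearest (k : ℕ) (d : Fin n → Fin n → ℕ∞) (A : Finset (Fin n)) : Prop :=
  ∀ v, (∃ p ∈ A, rankOf (d v) p < k) ∨ ∀ s, rankOf (d v) s < k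

/-- Following shortcuts along a shortest path from `z` to `y`, one reaches `y` or a node that has
a pivot at distance at most `D / m`. -/
theorem IsPathMetric.exists_pivot_or_hopDist_le (hd : IsPathMetric W d)
    (hA : HitsNearest k d A) (hBW : ∀ v u, B v u ≤ W v u)
    (hnear : ∀ v u, rankOf (d v) u < k → B v u ≤ d v u) {m : ℕ} (hm : 0 < m) (D : ℕ)
    (y : Fin n) (b : ℕ) (z : Fin n) (r : ℕ) (hr : d z y = r) (hb : m * r ≤ b * D) :
    hopDist B (2 * b) z y ≤ d z y ∨ ∃ z₁ p, p ∈ A ∧ rankOf (d z₁) p < k ∧ m * d z₁ p ≤ D ∧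
      d z z₁ + d z₁ y = d z y ∧ hopDist B (2 * b) z z₁ ≤ d z z₁ := by
  have hself : ∀ v, B v v = 0 := fun v => by simpa [hd.weight_self] using hBW v v
  induction b generalizing z r with
  | zero =>
    left
    have : r = 0 := by
      rw [zero_mul, Nat.le_zero, Nat.mul_eq_zero] at hb; omega
    subst this
    obtain rfl := hd.eq_of_zero z y hr
    simp [hopDist_zero_self]
  | succ b ih =>
    by_cases hp : ∃ p ∈ A, rankOf (d z) p < k ∧ m * d z p ≤ D
    · obtain ⟨p, hpA, hpk, hpD⟩ := hp
      exact Or.inr ⟨z, p, hpA, hpk, hpD, by simp [hd.self], by simp [hopDist_self hself]⟩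
    -- The pivot among the `k` nearest nodes is farther than D/m, so the whole ball of radius D/m
    -- lies within the `k` nearest nodes and is reached by shortcuts.
    have hball : ∀ t, m * d z t ≤ D → rankOf (d z) t < k := by
      intro t ht
      rcases hA z with ⟨p, hpA, hpk⟩ | hall
      · have h1 : ¬ (m * d z p ≤ D) := fun h => hp ⟨p, hpA, hpk, h⟩
        have h2 : d z t < d z p := by
          by_contra h
          exact h1 ((mul_le_mul_right (not_lt.1 h) _).trans ht)
        exact (rankOf_lt_rankOf (Or.inl h2)).trans hpk
      · exact hall t
    by_cases hy : m * d z y ≤ D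
    · exact Or.inl ((hopDist_le_of_le hself (by omega : 1 ≤ 2 * (b + 1)) z y).trans
        ((hopDist_one_le z y).trans (hnear z y (hball y hy))))
    -- One shortcut to the last node inside the ball and one graph edge out of it: two hops that
    -- advance more than D/m, which uses up one unit of `b`.
    obtain ⟨t, t', ht, ht', h1, h2⟩ := hd.exists_crossing (fun t => m * d z t ≤ D)
      (x := z) (y := y) (by simp [hd.self]) hy (by simp [hr])
    have hop2 : hopDist B 2 z t' ≤ d z t' := by
      refine (hopDist_succ_le 1 z t t').trans ?_
      rw [← h2]
      exact add_le_add (hnear z t (hball t ht)) ((hopDist_one_le t t').trans (hBW t t'))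
    rw [h2, hr] at h1
    have f1 : d z t' ≠ ⊤ := fun h => by simp [h] at h1
    have f2 : d t' y ≠ ⊤ := fun h => by simp [h] at h1
    obtain ⟨r₁, hr₁⟩ := ENat.ne_top_iff_exists.1 f1
    obtain ⟨r₂, hr₂⟩ := ENat.ne_top_iff_exists.1 f2
    rw [← hr₁, ← hr₂] at h1
    rw [← hr₁] at ht'
    norm_cast at h1 ht'
    have e2b : 2 * (b + 1) = 2 + 2 * b := by ring
    rw [e2b]
    rcases ih t' r₂ hr₂.symm (by rw [← h1] at hb; nlinarith) with h3 | ⟨z₁, p, hpA, hpk, hpD, h3, h4⟩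
    · left
      refine (hopDist_add_le 2 (2 * b) z t' y).trans ((add_le_add hop2 h3).trans ?_)
      rw [← hr₁, ← hr₂, hr, ← h1]; norm_cast
    · right
      rw [← hr₂] at h3
      have g1 : d t' z₁ ≠ ⊤ := fun h => by simp [h] at h3
      have g2 : d z₁ y ≠ ⊤ := fun h => by simp [h] at h3
      have h5 := hd.triangle z t' z₁
      have h6 := hd.triangle z z₁ y
      have h7 := (hopDist_add_le 2 (2 * b) z t' z₁).trans (add_le_add hop2 h4)
      obtain ⟨s₁, hs₁⟩ := ENat.ne_top_iff_exists.1 g1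
      obtain ⟨s₂, hs₂⟩ := ENat.ne_top_iff_exists.1 g2
      have g3 : d z z₁ ≠ ⊤ := ne_top_of_le_ne_top (by rw [← hr₁, ← hs₁]; exact WithTop.coe_ne_top) h5
      obtain ⟨s₃, hs₃⟩ := ENat.ne_top_iff_exists.1 g3
      rw [← hs₁, ← hs₂] at h3
      rw [← hs₁, ← hs₃, ← hr₁] at h5
      rw [← hs₂, ← hs₃, hr] at h6
      rw [← hs₁, ← hr₁] at h7
      norm_cast at h3 h5 h6
      refine ⟨z₁, p, hpA, hpk, hpD, ?_, h7.trans ?_⟩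
      · rw [hr, ← hs₂, ← hs₃]; norm_cast; omega
      · rw [← hs₃]; norm_cast; omega

/-- `B` has edges between the elements of `A` at distance at most `ρ` that are at most `μ` times
longer than the distance. -/
def ApproxOn (B d : Fin n → Fin n → ℕ∞) (A : Finset (Fin n)) (μ ρ : ℝ) : Prop :=
  ∀ p ∈ A, ∀ q ∈ A, ∀ r : ℕ, d p q = r → (r : ℝ) ≤ ρ → ∃ l : ℕ, B p q ≤ l ∧ (l : ℝ) ≤ μ * r

theorem ApproxOn.mono {B' : Fin n → Fin n → ℕ∞} {μ ρ : ℝ} (hB : ApproxOn B d A μ ρ)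
    (h : ∀ v u, B' v u ≤ B v u) : ApproxOn B' d A μ ρ := fun p hp q hq r hr hρ =>
  let ⟨l, hl, hl'⟩ := hB p hp q hq r hr hρ
  ⟨l, (h p q).trans hl, hl'⟩

theorem IsPathMetric.exists_hopDist_le_of_approxOn (hd : IsPathMetric W d)
    (hA : HitsNearest k d A) (hBW : ∀ v u, B v u ≤ W v u)
    (hnear : ∀ v u, rankOf (d v) u < k ∨ rankOf (d u) v < k → B v u ≤ d v u)
    {μ ρ : ℝ} (hμ : 1 ≤ μ) (hB : ApproxOn B d A μ ρ) {m : ℕ} (hm : 0 < m) {x y : Fin n} {D : ℕ}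
    (hD : d x y = D) (hρ : (1 + 2 / m) * (D : ℝ) ≤ ρ) :
    ∃ l : ℕ, hopDist B (4 * m + 3) x y ≤ l ∧ (l : ℝ) ≤ μ * (1 + 4 / m) * D := by
  have hself : ∀ v, B v v = 0 := fun v => by simpa [hd.weight_self] using hBW v v
  have hm' : (0 : ℝ) < m := by exact_mod_cast hm
  have hexact : (D : ℝ) ≤ μ * (1 + 4 / m) * D := by
    have h4 : (0 : ℝ) ≤ 4 / m := by positivity
    have : 1 ≤ μ * (1 + 4 / m) := by nlinarith
    have hD0 : (0 : ℝ) ≤ D := by positivity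
    nlinarith
  rcases hd.exists_pivot_or_hopDist_le hA hBW (fun v u h => hnear v u (Or.inl h)) hm D y m x D hD
    le_rfl with h | ⟨z₁, p₁, hp₁, hk₁, hD₁, hz₁, hx₁⟩
  · exact ⟨D, (hopDist_le_of_le hself (by omega) x y).trans (h.trans hD.le), hexact⟩
  rw [hD] at hz₁
  have f1 : d x z₁ ≠ ⊤ := fun h => by simp [h] at hz₁
  have f2 : d z₁ y ≠ ⊤ := fun h => by simp [h] at hz₁
  obtain ⟨a, ha⟩ := ENat.ne_top_iff_exists.1 f1
  obtain ⟨g, hg⟩ := ENat.ne_top_iff_exists.1 f2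
  rw [← ha, ← hg] at hz₁
  norm_cast at hz₁
  rcases hd.exists_pivot_or_hopDist_le (B := fun v u => B u v) hA
    (fun v u => (hBW u v).trans (hd.weight_symm u v).le)
    (fun v u h => (hnear u v (Or.inr h)).trans (hd.symm u v).le) hm D z₁ m y g
    -- The walk from `y` is aimed at `z₁`, not at `x`, so that the two explored ends cannot overlap.
    (by rw [hd.symm, hg]) (Nat.mul_le_mul_left _ (by omega)) with
    h | ⟨z₂, p₂, hp₂, hk₂, hD₂, hz₂, hy₂⟩
  · have h' := (hopDist_transpose_le (B := fun v u => B u v) (2 * m) y z₁).trans h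
    refine ⟨D, (hopDist_le_of_le hself (by omega : 2 * m + 2 * m ≤ 4 * m + 3) x y).trans ?_, hexact⟩
    refine (hopDist_add_le _ _ x z₁ y).trans ((add_le_add hx₁ h').trans ?_)
    rw [hd.symm y z₁, ← ha, ← hg, ← hz₁]; norm_cast
  have h' := (hopDist_transpose_le (B := fun v u => B u v) (2 * m) y z₂).trans hy₂
  rw [hd.symm y z₁, ← hg] at hz₂
  have f3 : d y z₂ ≠ ⊤ := fun h => by simp [h] at hz₂
  have f4 : d z₂ z₁ ≠ ⊤ := fun h => by simp [h] at hz₂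
  have f5 : d z₁ p₁ ≠ ⊤ := fun h => by simp [h, hm.ne'] at hD₁
  have f6 : d z₂ p₂ ≠ ⊤ := fun h => by simp [h, hm.ne'] at hD₂
  obtain ⟨b, hb⟩ := ENat.ne_top_iff_exists.1 f3
  obtain ⟨c, hc⟩ := ENat.ne_top_iff_exists.1 f4
  obtain ⟨e₁, he₁⟩ := ENat.ne_top_iff_exists.1 f5
  obtain ⟨e₂, he₂⟩ := ENat.ne_top_iff_exists.1 f6
  have tri : d p₁ p₂ ≤ ((e₁ + c + e₂ : ℕ) : ℕ∞) := by
    refine (hd.triangle p₁ z₁ p₂).trans ?_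
    push_cast
    rw [hd.symm p₁ z₁, he₁, add_assoc]
    refine add_le_add_right ((hd.triangle z₁ z₂ p₂).trans ?_) _
    rw [hd.symm z₁ z₂, hc, he₂]
  obtain ⟨r, hr⟩ := ENat.ne_top_iff_exists.1 (ne_top_of_le_ne_top (ENat.natCast_ne_top _) tri)
  rw [← hr] at tri
  rw [← hb, ← hc] at hz₂
  rw [← he₁] at hD₁
  rw [← he₂] at hD₂
  norm_cast at tri hz₂ hD₁ hD₂
  have q1 : (m : ℝ) * e₁ ≤ D := by exact_mod_cast hD₁
  have q2 : (m : ℝ) * e₂ ≤ D := by exact_mod_cast hD₂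
  have q3 : (e₁ : ℝ) ≤ D / m := by rw [le_div_iff₀ hm']; linarith
  have q4 : (e₂ : ℝ) ≤ D / m := by rw [le_div_iff₀ hm']; linarith
  have q5 : (r : ℝ) ≤ e₁ + c + e₂ := by exact_mod_cast tri
  have q6 : (a : ℝ) + (b + c) = D := by rw [← hz₁, ← hz₂]; push_cast; ring
  have a0 : (0 : ℝ) ≤ a := by positivity
  have b0 : (0 : ℝ) ≤ b := by positivity
  obtain ⟨l, hl, hlr⟩ := hB p₁ hp₁ p₂ hp₂ r hr.symm (by
    refine le_trans ?_ hρ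
    have : (1 + 2 / (m : ℝ)) * D = D + D / m + D / m := by ring
    linarith)
  -- The path is x, z₁, p₁, p₂, z₂, y with 2m + 1 + 1 + 1 + 2m hops. The visits to the pivots add at
  -- most 2(e₁ + e₂) ≤ 4D/m to the length before the factor `μ`.
  refine ⟨a + (e₁ + (l + (e₂ + b))), ?_, ?_⟩
  · have s1 : hopDist B (2 * m + (1 + (1 + (1 + 2 * m)))) x y ≤
        d x z₁ + (d z₁ p₁ + (l + (d z₂ p₂ + d y z₂))) := by
      refine (hopDist_add_le _ _ x z₁ y).trans (add_le_add hx₁ ?_)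
      refine (hopDist_add_le _ _ z₁ p₁ y).trans (add_le_add
        ((hopDist_one_le _ _).trans (hnear _ _ (Or.inl hk₁))) ?_)
      refine (hopDist_add_le _ _ p₁ p₂ y).trans (add_le_add ((hopDist_one_le _ _).trans hl) ?_)
      refine (hopDist_add_le _ _ p₂ z₂ y).trans (add_le_add
        ((hopDist_one_le _ _).trans ((hnear _ _ (Or.inr hk₂)).trans (hd.symm _ _).le)) h')
    rw [show 2 * m + (1 + (1 + (1 + 2 * m))) = 4 * m + 3 by ring] at s1
    rw [← ha, ← hb, ← he₁, ← he₂] at s1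
    exact_mod_cast s1
  · push_cast
    have t1 : (l : ℝ) ≤ μ * (e₁ + c + e₂) :=
      hlr.trans (mul_le_mul_of_nonneg_left q5 (by linarith))
    have e10 : (0 : ℝ) ≤ e₁ := by positivity
    have e20 : (0 : ℝ) ≤ e₂ := by positivity
    have t2 : (a : ℝ) + e₁ + e₂ + b ≤ μ * (a + e₁ + e₂ + b) := by nlinarith
    have t3 : μ * (a + e₁ + e₂ + b) + μ * (e₁ + c + e₂) ≤ μ * (1 + 4 / m) * D := by
      have : μ * (1 + 4 / m) * (D : ℝ) = μ * (D + 4 * (D / m)) := by ring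
      rw [this, ← mul_add]
      exact mul_le_mul_of_nonneg_left (by linarith) (by linarith)
    linarith

/-- One doubling step: approximate edges up to distance `ρ` give approximate paths with few hops
up to distance `3 / 2 * ρ`. -/
theorem IsPathMetric.exists_hopDist_le_of_le (hd : IsPathMetric W d)
    (hA : HitsNearest k d A) (hBW : ∀ v u, B v u ≤ W v u)
    (hnear : ∀ v u, rankOf (d v) u < k ∨ rankOf (d u) v < k → B v u ≤ d v u)
    {μ ρ : ℝ} (hμ : 1 ≤ μ) (hB : ApproxOn B d A μ ρ) {m : ℕ} (hm : 6 ≤ m) {x y : Fin n} {D : ℕ}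
    (hD : d x y = D) (hρ : (D : ℝ) ≤ 3 / 2 * ρ) :
    ∃ l : ℕ, hopDist B (8 * m + 7) x y ≤ l ∧ (l : ℝ) ≤ μ * (1 + 4 / m) * D := by
  have hself : ∀ v, B v v = 0 := fun v => by simpa [hd.weight_self] using hBW v v
  rcases Nat.eq_zero_or_pos D with rfl | hD0
  · obtain rfl := hd.eq_of_zero x y hD
    exact ⟨0, by simp [hopDist_self hself], by simp⟩
  -- Cutting at the edge that crosses the midpoint leaves two parts of length at most D/2, hence
  -- 2(4m + 3) + 1 hops.
  obtain ⟨z, z', hz, hz', h1, h2⟩ := hd.exists_crossing (fun z => 2 * d x z ≤ D)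
    (x := x) (y := y) (by simp [hd.self]) (by rw [hD]; norm_cast; omega) (by simp [hD])
  have h3 := h2 ▸ h1
  rw [hD] at h1 h3
  have f1 : d x z ≠ ⊤ := fun h => by simp [h] at h1
  have f2 : W z z' ≠ ⊤ := fun h => by simp [h] at h1
  have f3 : d z' y ≠ ⊤ := fun h => by simp [h] at h1
  have f4 : d x z' ≠ ⊤ := fun h => by simp [h] at h3
  obtain ⟨a, ha⟩ := ENat.ne_top_iff_exists.1 f1
  obtain ⟨w, hw⟩ := ENat.ne_top_iff_exists.1 f2
  obtain ⟨b, hb⟩ := ENat.ne_top_iff_exists.1 f3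
  obtain ⟨c, hc⟩ := ENat.ne_top_iff_exists.1 f4
  rw [← ha, ← hw, ← hb] at h1
  rw [← hb, ← hc] at h3
  rw [← ha] at hz
  rw [← hc] at hz'
  norm_cast at h1 h3 hz hz'
  have hm' : (6 : ℝ) ≤ m := by exact_mod_cast hm
  have hfrac : 2 / (m : ℝ) ≤ 1 / 3 := by
    rw [div_le_div_iff₀ (by linarith) (by norm_num)]; linarith
  -- A half has length at most 3ρ/4, and 1 + 2/m ≤ 4/3 for m ≥ 6. This is why a scale gains the
  -- factor 3/2 rather than 2.
  have half : ∀ e : ℕ, 2 * e ≤ D → (1 + 2 / (m : ℝ)) * e ≤ ρ := by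
    intro e he
    have he' : (2 : ℝ) * e ≤ D := by exact_mod_cast he
    have e0 : (0 : ℝ) ≤ e := by positivity
    nlinarith
  obtain ⟨l₁, hl₁, hl₁'⟩ := hd.exists_hopDist_le_of_approxOn hA hBW hnear hμ hB
    (by omega) ha.symm (half a hz)
  obtain ⟨l₂, hl₂, hl₂'⟩ := hd.exists_hopDist_le_of_approxOn hA hBW hnear hμ hB
    (by omega) hb.symm (half b (by omega))
  refine ⟨l₁ + (w + l₂), ?_, ?_⟩
  · have s : hopDist B ((4 * m + 3) + (1 + (4 * m + 3))) x y ≤ l₁ + (W z z' + l₂) := by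
      refine (hopDist_add_le _ _ x z y).trans (add_le_add hl₁ ?_)
      refine (hopDist_add_le _ _ z z' y).trans (add_le_add ?_ hl₂)
      exact (hopDist_one_le _ _).trans (hBW _ _)
    rw [show (4 * m + 3) + (1 + (4 * m + 3)) = 8 * m + 7 by ring, ← hw] at s
    exact_mod_cast s
  · have hfac : 1 ≤ μ * (1 + 4 / m) := by
      have h4 : (0 : ℝ) ≤ 4 / m := by positivity
      nlinarith
    have w0 : (0 : ℝ) ≤ w := by positivity
    rw [← h1]
    push_cast
    nlinarith

end Hopset

/-! ### The hopset on the pivots -/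

section Scales

variable {n M k κ : ℕ} {W d R : Fin n → Fin n → ℕ∞} {A : Finset (Fin n)}

open Classical in
/-- The hopset on the pivots `A` after `j` scales. -/
noncomputable def pivotEdges (M κ h : ℕ) (B : Fin n → Fin n → ℕ∞) (A : Finset (Fin n)) :
    ℕ → Fin n → Fin n → ℕ∞
  | 0 => sourceMatrix A
  | j + 1 => fun v s => if v ∈ A then
      relax M κ h (fun v u => min (B v u) (pivotEdges M κ h B A j v u)) A v s else ⊤

theorem IsPathMetric.le_pivotEdges (hd : IsPathMetric W d) {B : Fin n → Fin n → ℕ∞}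
    (hB : ∀ v u, d v u ≤ B v u) (h j : ℕ) (v s : Fin n) :
    d v s ≤ pivotEdges M κ h B A j v s := by
  induction j generalizing v s with
  | zero => exact hd.le_relax (M := M) (k := κ) hB A 0 v s
  | succ j ih =>
    unfold pivotEdges
    split_ifs
    · exact hd.le_relax (fun v u => le_min (hB v u) (ih v u)) A h v s
    · exact le_top

theorem pivotEdges_eq_top (B : Fin n → Fin n → ℕ∞) (h j : ℕ) {v s : Fin n}
    (hvs : v ∉ A ∨ s ∉ A) : pivotEdges M κ h B A j v s = ⊤ := by
  cases j with
  | zero =>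
    refine if_neg ?_
    rintro ⟨rfl, h⟩
    tauto
  | succ j =>
    unfold pivotEdges
    split_ifs with hv
    · exact relax_eq_top h v (by tauto)
    · rfl

/-- At scale 0 the radius is 1/2, so by integrality only zero distances count. At each further scale
`exists_hopDist_le_of_le` bounds the hop distances that the pivots compute from one another. As the
error factor stays at most 2, all relevant values remain below `M`. -/
theorem IsPathMetric.approxOn_pivotEdges (hd : IsPathMetric W d)
    (hM : ∀ v u, d v u ≠ ⊤ → 2 * d v u < M) (hA : HitsNearest k d A) (hAκ : A.card ≤ κ)
    {B : Fin n → Fin n → ℕ∞} (hBW : ∀ v u, B v u ≤ W v u)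
    (hnear : ∀ v u, rankOf (d v) u < k ∨ rankOf (d u) v < k → B v u ≤ d v u)
    {m : ℕ} (hm : 6 ≤ m) (j : ℕ) (hj : (1 + 4 / (m : ℝ)) ^ j ≤ 2) :
    ApproxOn (pivotEdges M κ (8 * m + 7) B A j) d A
      ((1 + 4 / (m : ℝ)) ^ j) ((3 / 2) ^ j / 2) := by
  have h4 : (1 : ℝ) ≤ 1 + 4 / m := by
    have : (0 : ℝ) ≤ 4 / m := by positivity
    linarith
  induction j with
  | zero =>
    intro p hp q hq r hr hρ
    have hr0 : r = 0 := by
      have : (r : ℝ) < 1 := by norm_num at hρ; linarith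
      exact_mod_cast Nat.lt_one_iff.1 (by exact_mod_cast this)
    subst hr0
    obtain rfl := hd.eq_of_zero p q hr
    exact ⟨0, by simp [pivotEdges, sourceMatrix, hp], by simp⟩
  | succ j ih =>
    intro p hp q hq r hr hρ
    obtain ⟨l, hl, hl'⟩ := hd.exists_hopDist_le_of_le hA
      (fun v u => (min_le_left _ _).trans (hBW v u))
      (fun v u h => (min_le_left _ _).trans (hnear v u h)) (one_le_pow₀ h4)
      ((ih ((pow_le_pow_right₀ h4 (Nat.le_succ j)).trans hj)).mono
        (fun v u => min_le_right (B v u) _)) hm hr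
      (by rw [pow_succ] at hρ; linarith)
    rw [← pow_succ] at hl'
    refine ⟨l, ?_, hl'⟩
    unfold pivotEdges
    rw [if_pos hp]
    refine (relax_le_hopDist hAκ _ p hq (hl.trans_lt ?_)).trans hl
    have h2 : l ≤ 2 * r := by
      have r0 : (0 : ℝ) ≤ r := by positivity
      have : (l : ℝ) ≤ 2 * r := hl'.trans (mul_le_mul_of_nonneg_right hj r0)
      exact_mod_cast this
    refine lt_of_le_of_lt ?_ (hM p q (by simp [hr]))
    rw [hr]
    exact_mod_cast h2

/-- Estimates computed with the hopset have the required quality. -/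
theorem IsPathMetric.relax_le_of_approxOn (hd : IsPathMetric W d)
    (hM : ∀ v u, d v u ≠ ⊤ → 2 * d v u < M) (hA : HitsNearest k d A)
    {B : Fin n → Fin n → ℕ∞} (hBW : ∀ v u, B v u ≤ W v u)
    (hnear : ∀ v u, rankOf (d v) u < k ∨ rankOf (d u) v < k → B v u ≤ d v u)
    {m : ℕ} (hm : 6 ≤ m) {μ ρ ε : ℝ} (hμ : 1 ≤ μ) (hε : ε ≤ 1) (hμε : μ * (1 + 4 / m) ≤ 1 + ε)
    (hB : ApproxOn B d A μ ρ) {S : Finset (Fin n)} (hS : S.card ≤ κ) {v s : Fin n} (hs : s ∈ S)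
    {D : ℕ} (hD : d v s = D) (hρ : (D : ℝ) ≤ ρ) :
    ∃ l : ℕ, relax M κ (8 * m + 7) B S v s ≤ l ∧ (l : ℝ) ≤ (1 + ε) * D := by
  have D0 : (0 : ℝ) ≤ D := by positivity
  obtain ⟨l, hl, hl'⟩ := hd.exists_hopDist_le_of_le hA hBW hnear hμ hB hm hD (by linarith)
  have hl'' := hl'.trans (mul_le_mul_of_nonneg_right hμε D0)
  refine ⟨l, (relax_le_hopDist hS _ v hs (hl.trans_lt ?_)).trans hl, hl''⟩
  have h2 : l ≤ 2 * D := by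
    have : (l : ℝ) ≤ 2 * D := hl''.trans (mul_le_mul_of_nonneg_right (by linarith) D0)
    exact_mod_cast this
  refine lt_of_le_of_lt ?_ (hM v s (by simp [hD]))
  rw [hD]
  exact_mod_cast h2

end Scales

/-! ### The shortest-path metric of a weighted graph -/

namespace WGraph

variable {n : ℕ}

/-- The weights of the steps from `v` that a node with the given local view knows. -/
noncomputable def rowOfView (v : Fin n) (view : Fin n → Option ℕ) (u : Fin n) : ℕ∞ :=
  if v = u then 0 else (view u).elim ⊤ (fun w => (w : ℕ∞))

/-- The matrix of the edge weights, with zeros on the diagonal and `⊤` off the edges. -/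
noncomputable def weightMatrix (G : WGraph n) (v : Fin n) : Fin n → ℕ∞ :=
  rowOfView v (G.localView v)

/-- The weighted distance, as an extended natural number. -/
noncomputable def natDist (G : WGraph n) (u v : Fin n) : ℕ∞ :=
  ⨅ p : G.graph.Walk u v, (G.walkWeight p : ℕ∞)

variable (G : WGraph n)

theorem weightMatrix_self (v : Fin n) : G.weightMatrix v v = 0 := if_pos rfl

theorem weightMatrix_of_adj {v u : Fin n} (h : G.graph.Adj v u) :
    G.weightMatrix v u = G.w s(v, u) := by
  simp [weightMatrix, rowOfView, localView, h, h.ne]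

theorem weightMatrix_of_not_adj {v u : Fin n} (h : ¬ G.graph.Adj v u) (hne : v ≠ u) :
    G.weightMatrix v u = ⊤ := by
  simp [weightMatrix, rowOfView, localView, h, hne]

theorem natDist_le {u v : Fin n} (p : G.graph.Walk u v) : G.natDist u v ≤ G.walkWeight p :=
  iInf_le _ p

theorem exists_walkWeight_eq {u v : Fin n} (h : G.natDist u v ≠ ⊤) :
    ∃ p : G.graph.Walk u v, G.natDist u v = G.walkWeight p := by
  rcases isEmpty_or_nonempty (G.graph.Walk u v) with he | he
  · exact absurd (iInf_of_empty _) h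
  · obtain ⟨p, hp⟩ := ciInf_mem (fun p : G.graph.Walk u v => (G.walkWeight p : ℕ∞))
    exact ⟨p, hp.symm⟩

theorem dist_eq_natDist (u v : Fin n) : G.dist u v = (G.natDist u v : ℝ≥0∞) := by
  apply le_antisymm
  · by_cases h : G.natDist u v = ⊤
    · simp [h]
    · obtain ⟨p, hp⟩ := G.exists_walkWeight_eq h
      rw [hp]
      exact (iInf_le _ p).trans (by simp)
  · refine le_iInf fun p => ?_
    have := ENat.toENNReal_le.2 (G.natDist_le p)
    simpa using this

theorem walkWeight_cons {u v w : Fin n} (h : G.graph.Adj u v) (p : G.graph.Walk v w) :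
    G.walkWeight (SimpleGraph.Walk.cons h p) = G.w s(u, v) + G.walkWeight p := by
  simp [walkWeight]

theorem hopDist_length_le {u v : Fin n} (p : G.graph.Walk u v) :
    hopDist G.weightMatrix p.length u v ≤ G.walkWeight p := by
  induction p with
  | nil => simp [hopDist]
  | @cons u v w h p ih =>
    rw [walkWeight_cons, SimpleGraph.Walk.length_cons]
    refine (hopDist_succ_le _ u v w).trans ?_
    rw [G.weightMatrix_of_adj h]
    push_cast
    exact add_le_add_right ih _

theorem exists_path_walkWeight_eq {u v : Fin n} (h : G.natDist u v ≠ ⊤) :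
    ∃ p : G.graph.Walk u v, G.natDist u v = G.walkWeight p ∧ p.length < n := by
  classical
  obtain ⟨p, hp⟩ := G.exists_walkWeight_eq h
  refine ⟨p.bypass, le_antisymm (G.natDist_le _) ?_, ?_⟩
  · rw [hp]
    have : (p.bypass.edges.map G.w).sum ≤ (p.edges.map G.w).sum :=
      (p.edges_bypass_sublist_edges.map G.w).sum_le_sum (by simp)
    exact_mod_cast this
  · simpa using p.bypass_isPath.length_lt

variable {G}

theorem PolyWeights.isPathMetric {a : ℕ} (hG : G.PolyWeights a) :
    IsPathMetric G.weightMatrix G.natDist where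
  weight_self := G.weightMatrix_self
  weight_symm v u := by
    by_cases h : v = u
    · rw [h]
    · by_cases hadj : G.graph.Adj v u
      · rw [G.weightMatrix_of_adj hadj, G.weightMatrix_of_adj hadj.symm, Sym2.eq_swap]
      · rw [G.weightMatrix_of_not_adj hadj h,
          G.weightMatrix_of_not_adj (fun h' => hadj h'.symm) (Ne.symm h)]
  self v := by
    have := G.natDist_le (SimpleGraph.Walk.nil : G.graph.Walk v v)
    simpa [walkWeight] using this
  symm := by
    have key : ∀ v u, G.natDist v u ≤ G.natDist u v := fun v u => le_iInf fun p => by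
      refine (G.natDist_le p.reverse).trans ?_
      simp [walkWeight]
    exact fun v u => le_antisymm (key v u) (key u v)
  triangle v u s := by
    by_cases h1 : G.natDist v u = ⊤
    · simp [h1]
    by_cases h2 : G.natDist u s = ⊤
    · simp [h2]
    obtain ⟨p, hp⟩ := G.exists_walkWeight_eq h1
    obtain ⟨q, hq⟩ := G.exists_walkWeight_eq h2
    rw [hp, hq]
    refine (G.natDist_le (p.append q)).trans ?_
    simp [walkWeight]
  eq_of_zero v u h := by
    obtain ⟨p, hp⟩ := G.exists_walkWeight_eq (u := v) (v := u) (by simp [h])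
    cases p with
    | nil => rfl
    | cons hadj p =>
      have h1 := (hG _ (G.graph.mem_edgeSet.2 hadj)).1
      rw [h, walkWeight_cons] at hp
      norm_cast at hp
      omega
  le_weight v u := by
    by_cases h : v = u
    · subst h
      have := G.natDist_le (SimpleGraph.Walk.nil : G.graph.Walk v v)
      rw [G.weightMatrix_self]
      simpa [walkWeight] using this
    · by_cases hadj : G.graph.Adj v u
      · refine (G.natDist_le (SimpleGraph.Walk.cons hadj SimpleGraph.Walk.nil)).trans ?_
        rw [G.weightMatrix_of_adj hadj]
        simp [walkWeight]
      · rw [G.weightMatrix_of_not_adj hadj h]; exact le_top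
  hopDist_le v u := by
    by_cases h : G.natDist v u = ⊤
    · rw [h]; exact le_top
    obtain ⟨p, hp, hlen⟩ := G.exists_path_walkWeight_eq h
    rw [hp]
    exact (hopDist_le_of_le G.weightMatrix_self hlen.le v u).trans (G.hopDist_length_le p)

theorem PolyWeights.natDist_le {a : ℕ} (hG : G.PolyWeights a) {u v : Fin n}
    (h : G.natDist u v ≠ ⊤) : G.natDist u v ≤ ((n ^ (a + 1) : ℕ) : ℕ∞) := by
  obtain ⟨p, hp, hlen⟩ := G.exists_path_walkWeight_eq h
  rw [hp]
  have h1 : G.walkWeight p ≤ (p.edges.map G.w).length • n ^ a := by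
    refine List.sum_le_card_nsmul _ _ fun x hx => ?_
    obtain ⟨e, he, rfl⟩ := List.mem_map.1 hx
    exact (hG e (p.edges_subset_edgeSet he)).2
  rw [List.length_map, SimpleGraph.Walk.length_edges, smul_eq_mul] at h1
  have h2 : G.walkWeight p ≤ n ^ (a + 1) := by
    rw [pow_succ']
    exact h1.trans (Nat.mul_le_mul_right _ hlen.le)
  exact_mod_cast h2

theorem PolyWeights.weightMatrix_le {a : ℕ} (hG : G.PolyWeights a) {u v : Fin n}
    (h : G.weightMatrix u v ≠ ⊤) : G.weightMatrix u v ≤ ((n ^ a : ℕ) : ℕ∞) := by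
  by_cases huv : u = v
  · subst huv; rw [weightMatrix_self]; exact bot_le
  · by_cases hadj : G.graph.Adj u v
    · rw [weightMatrix_of_adj G hadj]
      exact_mod_cast (hG _ (G.graph.mem_edgeSet.2 hadj)).2
    · exact absurd (weightMatrix_of_not_adj G hadj huv) h

variable (G) in
/-- The total number of finite entries of the weight matrix. -/
theorem sum_card_weightMatrix_ne_top [DecidablePred fun x : ℕ∞ => x ≠ ⊤] :
    ∑ v, (Finset.univ.filter (fun u => G.weightMatrix v u ≠ ⊤)).card ≤ n + 2 * G.numEdges := by
  classical
  have h1 : ∀ v, (Finset.univ.filter (fun u => G.weightMatrix v u ≠ ⊤)).card ≤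
      1 + G.graph.degree v := by
    intro v
    have hsub : Finset.univ.filter (fun u => G.weightMatrix v u ≠ ⊤) ⊆
        insert v (G.graph.neighborFinset v) := by
      intro u
      simp only [Finset.mem_filter, Finset.mem_univ, true_and, Finset.mem_insert,
        SimpleGraph.mem_neighborFinset]
      intro h
      by_contra hc
      rw [not_or] at hc
      exact h (G.weightMatrix_of_not_adj hc.2 (Ne.symm hc.1))
    refine (Finset.card_le_card hsub).trans ((Finset.card_insert_le _ _).trans ?_)
    rw [SimpleGraph.card_neighborFinset_eq_degree, add_comm]
  refine (Finset.sum_le_sum fun v _ => h1 v).trans ?_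
  rw [Finset.sum_add_distrib, G.graph.sum_degrees_eq_twice_card_edges, numEdges,
    Set.ncard_eq_toFinset_card', SimpleGraph.edgeFinset]
  simp

end WGraph

/-! ### The phases of the algorithm as protocols -/

/-- The set of nodes whose flag is set. -/
def flagSet {n : ℕ} (b : Fin n → Bool) : Finset (Fin n) := Finset.univ.filter (fun v => b v = true)

theorem mem_flagSet {n : ℕ} (b : Fin n → Bool) (v : Fin n) : v ∈ flagSet b ↔ b v = true := by
  simp [flagSet]

open Classical in
theorem sourceMatrix_flagSet {n : ℕ} (b : Fin n → Bool) :
    sourceMatrix (flagSet b) = fun v s => if v = s ∧ b v = true then (0 : ℕ∞) else ⊤ := by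
  funext v s
  simp only [sourceMatrix, mem_flagSet]
  by_cases hvs : v = s <;> simp [hvs]

theorem realizes_withShortcuts {n B M q : ℕ} (hn : 0 < n) (hq : n ≤ q * q)
    (hq' : q * q ≤ 4 * n) (hB : Fintype.card (Entry n M) ≤ 2 ^ B) (t T : ℕ) :
    Realizes n B (T * productRounds t + 1) (fun R : Fin n → Fin n → ℕ∞ =>
      withShortcuts M (q * t) T R) := by
  have : NeZero n := ⟨hn.ne'⟩
  have h1 := ((realizes_filteredProduct hn hq hq' hB t).withLocal
    (fun _ (x : Fin n → ℕ∞) => (x, x)) (fun _ _ y => y)).iterate T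
  have h2 := h1.withLocal (fun _ x => x) (fun _ x y => (x, y))
  -- One more round transposes the matrix of near distances; sending its entries as symbols causes
  -- the truncation in `withShortcuts`.
  have h3 := (Realizes.exchange (n := n) (B := B) (M := Entry n M) hB 1
    (fun _ (x : (Fin n → ℕ∞) × (Fin n → ℕ∞)) v _ => (0, encodeValue M (x.2 v)))).withLocal
    (fun _ x => x) (fun _ x y u => min (x.1 u) (min (x.2 u) (decodeValue (y u 0).2)))
  convert h3.comp h2 using 1
  funext R v u
  simp only [decodeValue_encodeValue]
  rfl

theorem realizes_relax {n B M q : ℕ} (hn : 0 < n) (hq : n ≤ q * q)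
    (hq' : q * q ≤ 4 * n) (hB : Fintype.card (Entry n M) ≤ 2 ^ B) (t h : ℕ) :
    Realizes n B (h * productRounds t) (fun x : Fin n → (Fin n → ℕ∞) × Bool =>
      relax M (q * t) h (fun v => (x v).1) (flagSet fun v => (x v).2)) := by
  classical
  have h1 := ((realizes_filteredProduct hn hq hq' hB t).withLocal
    (fun _ (x : (Fin n → ℕ∞) × (Fin n → ℕ∞)) => x) (fun _ x y => (x.1, y))).iterate h
  have h2 := h1.withLocal (γ := (Fin n → ℕ∞) × Bool)
    (fun v x => (x.1, fun s => if v = s ∧ x.2 = true then 0 else ⊤)) (fun _ _ y => y.2)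
  convert h2 using 1
  funext x v
  clear h1 h2
  have key : ∀ X : Fin n → Fin n → ℕ∞,
      (fun (z : Fin n → (Fin n → ℕ∞) × (Fin n → ℕ∞)) v => ((z v).1,
        filteredProduct M (q * t) (fun v => (z v).1) (fun v => (z v).2) v))^[h]
        (fun v => ((x v).1, X v)) =
      fun v => ((x v).1, (filteredProduct M (q * t) (fun v => (x v).1))^[h] X v) := by
    induction h with
    | zero => intro X; rfl
    | succ h ih =>
      intro X
      rw [Function.iterate_succ_apply, Function.iterate_succ_apply, ← ih]
  rw [relax, sourceMatrix_flagSet]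
  exact (congrArg Prod.snd (congrFun (key _) v)).symm

theorem realizes_pivotEdges {n B M q : ℕ} (hn : 0 < n) (hq : n ≤ q * q)
    (hq' : q * q ≤ 4 * n) (hB : Fintype.card (Entry n M) ≤ 2 ^ B) (t h J : ℕ) :
    Realizes n B (J * (h * productRounds t)) (fun x : Fin n → (Fin n → ℕ∞) × Bool =>
      pivotEdges M (q * t) h (fun v => (x v).1) (flagSet fun v => (x v).2) J) := by
  classical
  have h1 := ((realizes_relax hn hq hq' hB t h).withLocal
    (fun _ (x : ((Fin n → ℕ∞) × Bool) × (Fin n → ℕ∞)) => (fun u => min (x.1.1 u) (x.2 u), x.1.2))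
    (fun _ x y => (x.1, if x.1.2 = true then y else fun _ => ⊤))).iterate J
  have h2 := h1.withLocal (γ := (Fin n → ℕ∞) × Bool)
    (fun v x => (x, fun s => if v = s ∧ x.2 = true then 0 else ⊤)) (fun _ _ y => y.2)
  convert h2 using 1
  funext x v
  clear h1 h2
  have key : (fun (z : Fin n → ((Fin n → ℕ∞) × Bool) × (Fin n → ℕ∞)) v => ((z v).1,
        if (z v).1.2 = true then relax M (q * t) h (fun v u => min ((z v).1.1 u) ((z v).2 u))
          (flagSet fun v => (z v).1.2) v else fun _ => ⊤))^[J]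
        (fun v => (x v, sourceMatrix (flagSet fun v => (x v).2) v)) =
      fun v => (x v, pivotEdges M (q * t) h (fun v => (x v).1) (flagSet fun v => (x v).2) J v) := by
    induction J with
    | zero => rfl
    | succ J ih =>
      rw [Function.iterate_succ_apply', ih]
      funext v
      simp only [pivotEdges, mem_flagSet, Prod.mk.injEq, true_and]
      split_ifs <;> rfl
  rw [sourceMatrix_flagSet] at key
  exact (congrArg Prod.snd (congrFun key v)).symm

/-! ### Random pivots -/

/-- An event that depends on the coins of one node only. -/
theorem card_filter_apply_eq {n : ℕ} {C : Type} [Fintype C] [DecidableEq C] (i : Fin n)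
    (P : C → Prop) [DecidablePred P] :
    (Finset.univ.filter (fun ω : Fin n → C => P (ω i))).card * Fintype.card C =
      (Finset.univ.filter P).card * Fintype.card (Fin n → C) := by
  let e := Equiv.funSplitAt i C
  have h1 : (Finset.univ.filter (fun ω : Fin n → C => P (ω i))).card =
      (Finset.univ.filter P).card * Fintype.card ({j // j ≠ i} → C) := by
    rw [← Finset.card_univ, ← Finset.card_product]
    refine Finset.card_bij (fun ω _ => e ω) ?_ (fun _ _ _ _ h => e.injective h) ?_
    · intro ω hω
      simpa [e, Equiv.funSplitAt] using hω
    · intro z hz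
      refine ⟨e.symm z, ?_, e.apply_symm_apply z⟩
      have : (e (e.symm z)).1 = z.1 := by rw [e.apply_symm_apply]
      simp only [Finset.mem_filter, Finset.mem_univ, true_and]
      simp only [Finset.mem_product, Finset.mem_filter, Finset.mem_univ, true_and, and_true] at hz
      rw [← this] at hz
      simpa [e, Equiv.funSplitAt] using hz
  rw [h1, Fintype.card_congr e, Fintype.card_prod]
  ring

/-- The number of sequences of `q` elements of a set of size `N` that avoid a given subset. -/
theorem card_filter_forall_notMem {q : ℕ} {X : Type} [Fintype X] [DecidableEq X] (F : Finset X) :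
    (Finset.univ.filter (fun f : Fin q → X => ∀ i, f i ∉ F)).card =
      (Fintype.card X - F.card) ^ q := by
  have : Finset.univ.filter (fun f : Fin q → X => ∀ i, f i ∉ F) =
      Fintype.piFinset (fun _ => Fᶜ) := by
    ext f; simp [Fintype.mem_piFinset]
  rw [this, Fintype.card_piFinset]
  simp [Finset.card_compl]

/-- A random set of at most `q` nodes that is likely to hit `n` given sets of size `q * t`. -/
theorem exists_sampler {n q t d : ℕ} (hn : 2 ≤ n) (hq : n ≤ q * q)
    (ht : 2 * (d + 1) * Real.log n ≤ t) :
    ∃ (r : ℕ) (sample : Coins r → Finset (Fin n)), (∀ c, (sample c).card ≤ q) ∧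
      ∀ F : Fin n → Finset (Fin n), (∀ v, q * t ≤ (F v).card) →
        ((Finset.univ.filter (fun c => ∃ v, Disjoint (sample c) (F v))).card : ℝ) ≤
          Fintype.card (Coins r) / (n : ℝ) ^ d := by
  classical
  set b := Nat.clog 2 n with hb
  have hnb : n ≤ 2 ^ b := Nat.le_pow_clog (by norm_num) n
  have hbn : 2 ^ b ≤ 2 * n := by
    have h1 : 2 ^ (b - 1) < n := Nat.pow_pred_clog_lt_self (by norm_num) (by omega)
    have h2 : 0 < b := Nat.clog_pos (by norm_num) hn
    obtain ⟨b', hb'⟩ : ∃ b', b = b' + 1 := ⟨b - 1, by omega⟩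
    rw [hb', pow_succ]
    rw [hb', Nat.add_sub_cancel] at h1
    omega
  -- The coins encode `q` independent uniform draws from 2^b ≥ n values; draws outside the image of
  -- `ι` are wasted, which costs at most a factor 2 since 2^b ≤ 2n.
  let e : Coins (b * q) ≃ (Fin q → Fin (2 ^ b)) :=
    Fintype.equivOfCardEq (by simp [pow_mul])
  let ι : Fin n → Fin (2 ^ b) := Fin.castLE hnb
  have hι : Function.Injective ι := Fin.castLE_injective hnb
  refine ⟨b * q, fun c => Finset.univ.filter (fun v => ∃ i, e c i = ι v), fun c => ?_,
    fun F hF => ?_⟩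
  · have : (Finset.univ.filter (fun v => ∃ i, e c i = ι v)).image ι ⊆ Finset.univ.image (e c) := by
      intro x
      simp only [Finset.mem_image, Finset.mem_filter, Finset.mem_univ, true_and]
      rintro ⟨v, ⟨i, hi⟩, rfl⟩
      exact ⟨i, hi⟩
    have h2 := Finset.card_le_card this
    rw [Finset.card_image_of_injective _ hι] at h2
    exact h2.trans (Finset.card_image_le.trans (by simp))
  · have hcard : Fintype.card (Coins (b * q)) = (2 ^ b) ^ q := by simp [pow_mul]
    have single : ∀ v, ((Finset.univ.filter (fun c : Coins (b * q) =>
        Disjoint (Finset.univ.filter (fun v => ∃ i, e c i = ι v)) (F v))).card : ℝ) ≤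
        (2 ^ b) ^ q / (n : ℝ) ^ (d + 1) := by
      intro v
      have h1 : (Finset.univ.filter (fun c : Coins (b * q) =>
          Disjoint (Finset.univ.filter (fun v => ∃ i, e c i = ι v)) (F v))).card ≤
          (2 ^ b - q * t) ^ q := by
        have h2 : (Finset.univ.filter (fun c : Coins (b * q) =>
            Disjoint (Finset.univ.filter (fun v => ∃ i, e c i = ι v)) (F v))).card ≤
            (Finset.univ.filter (fun f : Fin q → Fin (2 ^ b) =>
              ∀ i, f i ∉ (F v).image ι)).card := by
          refine Finset.card_le_card_of_injOn e ?_ e.injective.injOn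
          intro c hc
          simp only [Finset.coe_filter, Finset.mem_univ, true_and, Set.mem_ofPred_eq,
            Finset.mem_image, not_exists, not_and] at hc ⊢
          intro i u hu hiu
          exact Finset.disjoint_left.1 hc
            (by simpa using ⟨i, hiu.symm⟩ : u ∈ Finset.univ.filter _) hu
        refine h2.trans ?_
        rw [card_filter_forall_notMem, Finset.card_image_of_injective _ hι, Fintype.card_fin]
        exact Nat.pow_le_pow_left (Nat.sub_le_sub_left (hF v) _) q
      have hqt : q * t ≤ 2 ^ b := (hF v).trans ((Finset.card_le_univ _).trans (by simpa using hnb))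
      have hn0 : (0 : ℝ) < n := by positivity
      have hN0 : (0 : ℝ) < 2 ^ b := by positivity
      -- A single draw misses a set of size at least qt with probability at most exp(-qt/(2n)). All
      -- `q` draws miss it with probability at most exp(-t/2) ≤ n^(-(d+1)), and the union bound over
      -- the nodes costs the remaining factor n.
      have h3 : ((2 ^ b - q * t : ℕ) : ℝ) ≤ 2 ^ b * Real.exp (-(q * t / (2 * n))) := by
        rw [Nat.cast_sub hqt]
        push_cast
        have h4 : (2 : ℝ) ^ b ≤ 2 * n := by exact_mod_cast hbn
        have h5 : 1 - (q * t / (2 * n) : ℝ) ≤ Real.exp (-(q * t / (2 * n))) :=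
          Real.one_sub_le_exp_neg _
        have h6 : (q * t / (2 * n) : ℝ) * 2 ^ b ≤ q * t := by
          rw [div_mul_eq_mul_div, div_le_iff₀ (by positivity)]
          exact mul_le_mul_of_nonneg_left h4 (by positivity)
        nlinarith
      have h7 : ((2 ^ b - q * t : ℕ) : ℝ) ^ q ≤ (2 ^ b) ^ q * Real.exp (-(t / 2)) := by
        refine (pow_le_pow_left₀ (by positivity) h3 q).trans ?_
        rw [mul_pow, ← Real.exp_nat_mul]
        refine mul_le_mul_of_nonneg_left (Real.exp_le_exp.2 ?_) (by positivity)
        have h8 : (n : ℝ) ≤ q * q := by exact_mod_cast hq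
        have h9 : (t : ℝ) / 2 ≤ q * (q * t / (2 * n)) := by
          rw [mul_div_assoc', div_le_div_iff₀ (by norm_num) (by positivity)]
          have : (0 : ℝ) ≤ t := by positivity
          nlinarith
        linarith
      have h10 : Real.exp (-(t / 2)) ≤ 1 / (n : ℝ) ^ (d + 1) := by
        rw [← Real.exp_log (by positivity : (0 : ℝ) < 1 / (n : ℝ) ^ (d + 1))]
        apply Real.exp_le_exp.2
        rw [one_div, Real.log_inv, Real.log_pow]
        push_cast
        linarith
      calc _ ≤ (((2 ^ b - q * t : ℕ) ^ q : ℕ) : ℝ) := by exact_mod_cast h1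
        _ = ((2 ^ b - q * t : ℕ) : ℝ) ^ q := by push_cast; rfl
        _ ≤ (2 ^ b) ^ q * Real.exp (-(t / 2)) := h7
        _ ≤ (2 ^ b) ^ q * (1 / (n : ℝ) ^ (d + 1)) :=
          mul_le_mul_of_nonneg_left h10 (by positivity)
        _ = _ := by ring
    have union : (Finset.univ.filter (fun c : Coins (b * q) => ∃ v,
        Disjoint (Finset.univ.filter (fun v => ∃ i, e c i = ι v)) (F v))).card ≤
        ∑ v, (Finset.univ.filter (fun c : Coins (b * q) =>
          Disjoint (Finset.univ.filter (fun v => ∃ i, e c i = ι v)) (F v))).card := by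
      refine le_trans (Finset.card_le_card ?_) Finset.card_biUnion_le
      intro c
      simp
    have hn0 : (n : ℝ) ≠ 0 := by positivity
    calc _ ≤ ∑ v : Fin n, ((Finset.univ.filter (fun c : Coins (b * q) =>
          Disjoint (Finset.univ.filter (fun v => ∃ i, e c i = ι v)) (F v))).card : ℝ) := by
          exact_mod_cast union
      _ ≤ ∑ v : Fin n, (2 ^ b) ^ q / (n : ℝ) ^ (d + 1) := Finset.sum_le_sum fun v _ => single v
      _ = _ := by
        rw [hcard]
        simp only [Finset.sum_const, Finset.card_univ, Fintype.card_fin, nsmul_eq_mul]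
        push_cast
        field_simp
        ring

/-- An event that contains all coins at which node `i` avoids a rare bad event is likely. -/
theorem one_sub_le_coinProb {n r : ℕ} (i : Fin n) (bad : Coins r → Prop) [DecidablePred bad]
    {p : ℝ} (hbad : ((Finset.univ.filter bad).card : ℝ) ≤ Fintype.card (Coins r) * p)
    {E : Set (Fin n → Coins r)} (hE : ∀ ω, ¬ bad (ω i) → ω ∈ E) : 1 - p ≤ coinProb E := by
  classical
  have h1 := card_filter_apply_eq (n := n) i bad
  have hC : (0 : ℝ) < Fintype.card (Coins r) := by exact_mod_cast Fintype.card_pos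
  have hΩ : (0 : ℝ) < Fintype.card (Fin n → Coins r) := by exact_mod_cast Fintype.card_pos
  have h2 : ((Finset.univ.filter (fun ω : Fin n → Coins r => bad (ω i))).card : ℝ) ≤
      Fintype.card (Fin n → Coins r) * p := by
    have h1' : ((Finset.univ.filter (fun ω : Fin n → Coins r => bad (ω i))).card : ℝ) *
        Fintype.card (Coins r) = (Finset.univ.filter bad).card *
          Fintype.card (Fin n → Coins r) := by exact_mod_cast h1
    refine le_of_mul_le_mul_right ?_ hC
    rw [h1']
    calc _ ≤ (Fintype.card (Coins r) * p) * (Fintype.card (Fin n → Coins r) : ℝ) :=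
          mul_le_mul_of_nonneg_right hbad hΩ.le
      _ = _ := by ring
  have h3 : Fintype.card (Fin n → Coins r) ≤
      E.ncard + (Finset.univ.filter (fun ω : Fin n → Coins r => bad (ω i))).card := by
    rw [Set.ncard_eq_toFinset_card', ← Finset.card_univ]
    refine le_trans (Finset.card_le_card ?_) (Finset.card_union_le _ _)
    intro ω _
    by_cases hω : bad (ω i)
    · simp [hω]
    · simp [hE ω hω]
  have h4 : (Fintype.card (Fin n → Coins r) : ℝ) ≤ E.ncard +
      (Finset.univ.filter (fun ω : Fin n → Coins r => bad (ω i))).card := by exact_mod_cast h3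
  rw [coinProb, le_div_iff₀ hΩ]
  linarith

/-! ### The stored words -/

section Storage

variable {n M B : ℕ}

open Classical in
/-- The words that describe the finite entries of a row. -/
noncomputable def storeRow (enc : Entry n M ↪ Word B) (row : Fin n → ℕ∞) : List (Word B) :=
  (Finset.univ.filter (fun u => row u ≠ ⊤)).toList.map (fun u => enc (u, encodeValue M (row u)))

/-- The row that is described by a list of words. -/
noncomputable def loadRow [NeZero n] (enc : Entry n M ↪ Word B) (l : List (Word B)) :
    Fin n → ℕ∞ :=
  unpackVec (fun i : Fin l.length => Function.invFun enc (l.get i))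

theorem loadRow_storeRow [NeZero n] (enc : Entry n M ↪ Word B) (row : Fin n → ℕ∞) :
    loadRow enc (storeRow enc row) = fun s => truncAt M (row s) := by
  classical
  funext s
  apply le_antisymm
  · by_cases hs : row s = ⊤
    · rw [hs, truncAt_top]; exact le_top
    · have hmem : enc (s, encodeValue M (row s)) ∈ storeRow enc row :=
        List.mem_map.2 ⟨s, by simp [hs], rfl⟩
      obtain ⟨i, hi⟩ := List.mem_iff_get.1 hmem
      refine iInf₂_le_of_le i ?_ ?_
      · beta_reduce
        rw [hi, Function.leftInverse_invFun enc.injective]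
      · beta_reduce
        rw [hi, Function.leftInverse_invFun enc.injective, decodeValue_encodeValue]
  · refine le_iInf₂ fun i hi => ?_
    obtain ⟨u, -, hu⟩ := List.mem_map.1 (List.get_mem (storeRow enc row) i)
    beta_reduce at hi ⊢
    rw [← hu, Function.leftInverse_invFun enc.injective] at hi ⊢
    obtain rfl : u = s := hi
    rw [decodeValue_encodeValue]

open Classical in
theorem length_storeRow (enc : Entry n M ↪ Word B) (row : Fin n → ℕ∞) :
    (storeRow enc row).length = (Finset.univ.filter (fun u => row u ≠ ⊤)).card := by
  simp [storeRow]

end Storage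

/-! ### The two protocols -/

section Protocols

variable {n M B q : ℕ}

/-- The row of the graph together with the hopset that a node stores. -/
noncomputable def storedRow (M κ k T h J : ℕ) (W : Fin n → Fin n → ℕ∞) (A : Finset (Fin n))
    (v u : Fin n) : ℕ∞ :=
  min (W v u) (pivotEdges M κ h (withShortcuts M k T W) A J v u)

/-- Node 0 alone samples the pivots and tells every node in one round whether it is a pivot; the
coins of the other nodes are ignored. -/
theorem realizes_preprocessing (hn : 0 < n) (hq : n ≤ q * q) (hq' : q * q ≤ 4 * n)
    (hB : Fintype.card (Entry n M) ≤ 2 ^ B) (hB' : 2 ≤ 2 ^ B) (enc : Entry n M ↪ Word B)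
    {r : ℕ} (sample : Coins r → Finset (Fin n)) (t T h J : ℕ) :
    Realizes n B (1 + (T * productRounds t + 1) + J * (h * productRounds 1))
      (fun x : Fin n → (Fin n → Option ℕ) × Coins r => fun v => storeRow enc
        (storedRow M (q * 1) (q * t) T h J (fun v => WGraph.rowOfView v (x v).1)
          (sample (x ⟨0, hn⟩).2) v)) := by
  classical
  have h1 := (Realizes.exchange (n := n) (B := B) (M := Bool) (by simpa using hB') 1
    (fun _ (x : (Fin n → Option ℕ) × Coins r) v _ => decide (v ∈ sample x.2))).withLocal
    (fun _ x => x) (fun v x y => (WGraph.rowOfView v x.1, y ⟨0, hn⟩ 0))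
  have h2 := (realizes_withShortcuts hn hq hq' hB t T).withLocal
    (fun _ (x : (Fin n → ℕ∞) × Bool) => x.1) (fun _ x y => (x, y))
  have h3 := (realizes_pivotEdges hn hq hq' hB 1 h J).withLocal
    (fun _ (x : ((Fin n → ℕ∞) × Bool) × (Fin n → ℕ∞)) => (x.2, x.1.2))
    (fun _ x y => storeRow enc (fun u => min (x.1.1 u) (y u)))
  convert h3.comp (h2.comp h1) using 1
  funext x v
  have hA : (flagSet fun v => decide (v ∈ sample (x ⟨0, hn⟩).2)) = sample (x ⟨0, hn⟩).2 := by
    ext v; simp [mem_flagSet]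
  simp only [hA]
  rfl

/-- The shortcuts are recomputed because storing them would take about n^(3/2) log n words. -/
theorem realizes_query [NeZero n] (hn : 0 < n) (hq : n ≤ q * q) (hq' : q * q ≤ 4 * n)
    (hB : Fintype.card (Entry n M) ≤ 2 ^ B) (enc : Entry n M ↪ Word B) (t t' T h : ℕ) :
    Realizes n B ((T * productRounds t + 1) + h * productRounds t')
      (fun x : Fin n → List (Word B) × Bool => fun v s => ((relax M (q * t') h
        (withShortcuts M (q * t) T (fun v => loadRow enc (x v).1)) (flagSet fun v => (x v).2) v s :
          ℕ∞) : ℝ≥0∞)) := by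
  have h2 := (realizes_withShortcuts hn hq hq' hB t T).withLocal
    (fun _ (x : List (Word B) × Bool) => loadRow enc x.1) (fun _ x y => (y, x.2))
  have h3 := (realizes_relax hn hq hq' hB t' h).withLocal
    (fun _ (x : (Fin n → ℕ∞) × Bool) => x) (fun _ _ y s => ((y s : ℕ∞) : ℝ≥0∞))
  convert h3.comp h2 using 1

end Protocols

/-! ### Correctness and size -/

section Correctness

variable {n M k κ κ' T J m : ℕ} {W d : Fin n → Fin n → ℕ∞} {A : Finset (Fin n)}

theorem IsPathMetric.le_answer (hd : IsPathMetric W d) (h : ℕ) (S : Finset (Fin n))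
    (v s : Fin n) :
    d v s ≤ relax M κ' h (withShortcuts M k T
      (fun v u => truncAt M (storedRow M κ k T h J W A v u))) S v s :=
  hd.le_relax (hd.le_withShortcuts (fun v u => (le_min (hd.le_weight v u)
    (hd.le_pivotEdges (hd.le_withShortcuts hd.le_weight T) h J v u)).trans (le_truncAt M _)) T)
    S h v s

theorem IsPathMetric.answer_le (hd : IsPathMetric W d)
    (hM : ∀ v u, d v u ≠ ⊤ → 2 * d v u < M) (hWM : ∀ v u, W v u ≠ ⊤ → W v u < M)
    (hT : n ≤ 2 ^ T) (hA : HitsNearest k d A) (hAκ : A.card ≤ κ) (hm : 6 ≤ m) {ε : ℝ} (hε : ε ≤ 1)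
    (hmε : (1 + 4 / (m : ℝ)) ^ (J + 1) ≤ 1 + ε) {S : Finset (Fin n)} (hS : S.card ≤ κ')
    {v s : Fin n} (hs : s ∈ S) {D : ℕ} (hD : d v s = D) (hJ : (D : ℝ) ≤ (3 / 2) ^ J / 2) :
    ∃ l : ℕ, relax M κ' (8 * m + 7) (withShortcuts M k T
      (fun v u => truncAt M (storedRow M κ k T (8 * m + 7) J W A v u))) S v s ≤ l ∧
      (l : ℝ) ≤ (1 + ε) * D := by
  have hM' : ∀ v u, d v u ≠ ⊤ → d v u < M := fun v u h =>
    lt_of_le_of_lt (by rw [two_mul]; exact le_self_add) (hM v u h)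
  have h4 : (1 : ℝ) ≤ 1 + 4 / m := by
    have : (0 : ℝ) ≤ 4 / m := by positivity
    linarith
  have hpow : (1 + 4 / (m : ℝ)) ^ J ≤ 2 :=
    (pow_le_pow_right₀ h4 (Nat.le_succ J)).trans (hmε.trans (by linarith))
  have hdR : ∀ v u, d v u ≤ truncAt M (storedRow M κ k T (8 * m + 7) J W A v u) :=
    fun v u => (le_min (hd.le_weight v u) (hd.le_pivotEdges
      (hd.le_withShortcuts hd.le_weight T) _ J v u)).trans (le_truncAt M _)
  have hRW : ∀ v u, truncAt M (storedRow M κ k T (8 * m + 7) J W A v u) ≤ W v u := by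
    intro v u
    by_cases h : W v u = ⊤
    · rw [h]; exact le_top
    · refine (truncAt_mono M (min_le_left _ _)).trans ?_
      rw [truncAt_of_lt (hWM v u h)]
  have happ := hd.approxOn_pivotEdges (B := withShortcuts M k T W) hM hA hAκ
    (withShortcuts_le T)
    (fun v u => hd.withShortcuts_le_of_near hM' hd.le_weight (fun _ _ => le_rfl) hT) hm J hpow
  -- The quality of the hopset survives being truncated and reloaded, since the approximate lengths
  -- are at most 2r < M.
  have happR : ApproxOn (withShortcuts M k T
      (fun v u => truncAt M (storedRow M κ k T (8 * m + 7) J W A v u))) d A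
      ((1 + 4 / (m : ℝ)) ^ J) ((3 / 2) ^ J / 2) := by
    intro p hp q hq r hr hρ
    obtain ⟨l, hl, hl'⟩ := happ p hp q hq r hr hρ
    refine ⟨l, (withShortcuts_le T p q).trans
      ((truncAt_mono M ((min_le_right _ _).trans hl)).trans ?_), hl'⟩
    rw [truncAt_of_lt]
    refine lt_of_le_of_lt ?_ (hM p q (by simp [hr]))
    have r0 : (0 : ℝ) ≤ r := by positivity
    have : (l : ℝ) ≤ 2 * r := hl'.trans (mul_le_mul_of_nonneg_right hpow r0)
    rw [hr]
    exact_mod_cast this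
  exact hd.relax_le_of_approxOn hM hA
    (fun v u => (withShortcuts_le T v u).trans (hRW v u))
    (fun v u => hd.withShortcuts_le_of_near hM' hdR hRW hT) hm (one_le_pow₀ h4) hε
    (by rw [← pow_succ]; exact hmε) happR hS hs hD hJ

-- Outside A × A the hopset is `⊤`, so it adds at most `q` entries to each of at most `q` rows.
open Classical in
theorem sum_card_storedRow_ne_top (G : WGraph n) (h : ℕ) {q : ℕ} (hA : A.card ≤ q) :
    ∑ v, (Finset.univ.filter
      (fun u => storedRow M κ k T h J G.weightMatrix A v u ≠ ⊤)).card ≤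
      n + 2 * G.numEdges + q * q := by
  have h1 : ∀ v, (Finset.univ.filter
      (fun u => storedRow M κ k T h J G.weightMatrix A v u ≠ ⊤)).card ≤
      (Finset.univ.filter (fun u => G.weightMatrix v u ≠ ⊤)).card + if v ∈ A then q else 0 := by
    intro v
    have hsub : Finset.univ.filter
        (fun u => storedRow M κ k T h J G.weightMatrix A v u ≠ ⊤) ⊆
        Finset.univ.filter (fun u => G.weightMatrix v u ≠ ⊤) ∪ (if v ∈ A then A else ∅) := by
      intro u
      simp only [Finset.mem_filter, Finset.mem_univ, true_and, Finset.mem_union]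
      intro hu
      by_contra hc
      rw [not_or, not_not] at hc
      apply hu
      rw [storedRow, hc.1, pivotEdges_eq_top]
      · simp
      · by_cases hv : v ∈ A
        · rw [if_pos hv] at hc; exact Or.inr hc.2
        · exact Or.inl hv
    refine (Finset.card_le_card hsub).trans ((Finset.card_union_le _ _).trans ?_)
    split_ifs
    · omega
    · simp
  refine (Finset.sum_le_sum fun v _ => h1 v).trans ?_
  rw [Finset.sum_add_distrib]
  refine add_le_add G.sum_card_weightMatrix_ne_top ?_
  rw [← Finset.sum_filter]
  simp only [Finset.sum_const, smul_eq_mul]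
  refine Nat.mul_le_mul_right _ (le_trans (Finset.card_le_card ?_) hA)
  intro v; simp

end Correctness

/-! ### Parameters -/

/-- The power is at most exp(4(J+1)/m) ≤ exp(ε/2) ≤ 1 + ε. The exponent J + 1 counts the J scales
and the final query. -/
theorem one_add_four_div_pow_le {m J : ℕ} {ε : ℝ} (hε : 0 < ε) (hε' : ε ≤ 1)
    (hm : 8 * ((J : ℝ) + 1) / ε ≤ m) : (1 + 4 / (m : ℝ)) ^ (J + 1) ≤ 1 + ε := by
  have hJ : (0 : ℝ) < J + 1 := by positivity
  have hm0 : (0 : ℝ) < m := lt_of_lt_of_le (by positivity) hm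
  have h1 : (1 + 4 / (m : ℝ)) ^ (J + 1) ≤ Real.exp (ε / 2) := by
    have h2 : 1 + 4 / (m : ℝ) ≤ Real.exp (4 / m) := by
      have := Real.add_one_le_exp (4 / (m : ℝ)); linarith
    refine (pow_le_pow_left₀ (by positivity) h2 _).trans ?_
    rw [← Real.exp_nat_mul]
    apply Real.exp_le_exp.2
    rw [div_le_iff₀ hε] at hm
    rw [mul_div_assoc', div_le_div_iff₀ hm0 (by norm_num)]
    push_cast
    nlinarith
  have h3 := Real.abs_exp_sub_one_le (x := ε / 2) (by rw [abs_of_pos (by linarith)]; linarith)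
  rw [abs_of_pos (by linarith : 0 < ε / 2)] at h3
  have h4 := le_abs_self (Real.exp (ε / 2) - 1)
  linarith

theorem one_le_logb_two {n : ℕ} (hn : 2 ≤ n) : 1 ≤ Real.logb 2 n := by
  rw [Real.le_logb_iff_rpow_le (by norm_num) (by positivity)]
  simpa using (by exact_mod_cast hn : (2 : ℝ) ≤ n)

theorem clog_le_two_mul_logb {n : ℕ} (hn : 2 ≤ n) : (Nat.clog 2 n : ℝ) ≤ 2 * Real.logb 2 n := by
  have h1 := one_le_logb_two hn
  have h2 : 2 ^ (Nat.clog 2 n - 1) < n := Nat.pow_pred_clog_lt_self (by norm_num) (by omega)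
  have h3 : 0 < Nat.clog 2 n := Nat.clog_pos (by norm_num) hn
  have h4 : ((Nat.clog 2 n - 1 : ℕ) : ℝ) ≤ Real.logb 2 n := by
    rw [Real.le_logb_iff_rpow_le (by norm_num) (by positivity), Real.rpow_natCast]
    exact_mod_cast h2.le
  rw [Nat.cast_sub h3] at h4
  push_cast at h4
  linarith

theorem log_le_clog {n : ℕ} (hn : 2 ≤ n) : Real.log n ≤ Nat.clog 2 n := by
  have h1 : n ≤ 2 ^ Nat.clog 2 n := Nat.le_pow_clog (by norm_num) n
  have h2 : (n : ℝ) ≤ 2 ^ Nat.clog 2 n := by exact_mod_cast h1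
  have h3 := Real.log_le_log (by positivity) h2
  rw [Real.log_pow] at h3
  have h4 : Real.log 2 ≤ 1 := by have := Real.log_two_lt_d9; linarith
  have h5 : (0 : ℝ) ≤ Nat.clog 2 n := by positivity
  nlinarith

/-- The only property of `hopBeta` that is needed: its second factor has base at least 1 and
nonnegative exponent. -/
theorem le_hopBeta {n : ℕ} (hn : 2 ≤ n) {k ε : ℝ} (hk : 2 ≤ k) (hε : 0 < ε) (hε' : ε ≤ 1) :
    Real.logb 2 n ^ 2 / ε ≤ hopBeta n k ε := by
  have h1 := one_le_logb_two hn
  have h2 : 1 ≤ Real.logb 2 k := by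
    rw [Real.le_logb_iff_rpow_le (by norm_num) (by linarith)]; simpa using hk
  have h3 : 1 ≤ Real.logb 2 (k + 1) := by
    rw [Real.le_logb_iff_rpow_le (by norm_num) (by linarith)]; simp; linarith
  have h4 : 1 ≤ Real.logb 2 n * Real.logb 2 k / ε := by
    rw [le_div_iff₀ hε]; nlinarith
  exact le_mul_of_one_le_right (by positivity) (Real.one_le_rpow h4 (by linarith))

theorem card_entry_le {n a b : ℕ} (hn : 2 ≤ n) (hb : (a + 5) * Nat.clog 2 n ≤ b) :
    Fintype.card (Entry n (4 * n ^ (a + 1))) ≤ 2 ^ b := by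
  have h1 : n ≤ 2 ^ Nat.clog 2 n := Nat.le_pow_clog (by norm_num) n
  have h3 : 0 < Nat.clog 2 n := Nat.clog_pos (by norm_num) hn
  refine le_trans ?_ (Nat.pow_le_pow_right (by norm_num) hb)
  have h4 : 1 ≤ n ^ (a + 1) := Nat.one_le_pow _ _ (by omega)
  calc Fintype.card (Entry n (4 * n ^ (a + 1))) = n * (4 * n ^ (a + 1) + 1) := by simp
    _ ≤ n * (8 * n ^ (a + 1)) := Nat.mul_le_mul_left _ (by omega)
    _ = 2 ^ 3 * n ^ (a + 2) := by ring
    _ ≤ (2 ^ Nat.clog 2 n) ^ 3 * (2 ^ Nat.clog 2 n) ^ (a + 2) :=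
      Nat.mul_le_mul (Nat.pow_le_pow_left (by omega) 3) (Nat.pow_le_pow_left h1 _)
    _ = 2 ^ ((a + 5) * Nat.clog 2 n) := by rw [← pow_add, ← pow_mul]; congr 1; ring

theorem pow_le_three_halves_pow {n a : ℕ} (hn : 2 ≤ n) :
    ((n ^ (a + 1) : ℕ) : ℝ) ≤ (3 / 2) ^ (2 * (a + 2) * Nat.clog 2 n) / 2 := by
  have h1 : n ≤ 2 ^ Nat.clog 2 n := Nat.le_pow_clog (by norm_num) n
  have h2 : (n : ℝ) ≤ 2 ^ Nat.clog 2 n := by exact_mod_cast h1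
  have h3 : (2 : ℝ) ≤ n := by exact_mod_cast hn
  rw [le_div_iff₀ (by norm_num)]
  push_cast
  calc (n : ℝ) ^ (a + 1) * 2 ≤ n ^ (a + 1) * n :=
        mul_le_mul_of_nonneg_left h3 (by positivity)
    _ = n ^ (a + 2) := by ring
    _ ≤ (2 ^ Nat.clog 2 n) ^ (a + 2) := pow_le_pow_left₀ (by positivity) h2 _
    _ ≤ (((3 / 2 : ℝ) ^ 2) ^ Nat.clog 2 n) ^ (a + 2) := by
      gcongr; norm_num
    _ = _ := by rw [← pow_mul, ← pow_mul]; congr 1; ring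

/-- J + 1 ≤ (4a + 9)L for L = log₂ n, so 8m + 7 ≤ 64(4a + 9)L/ε + 15, and 576 + 15 = 591. -/
theorem hops_le {n a m : ℕ} (hn : 2 ≤ n) {ε : ℝ} (hε : 0 < ε) (hε' : ε ≤ 1)
    (hm : (m : ℝ) ≤ 8 * (((2 * (a + 2) * Nat.clog 2 n : ℕ) : ℝ) + 1) / ε + 1) :
    ((8 * m + 7 : ℕ) : ℝ) ≤ (256 * a + 591) * (Real.logb 2 n / ε) := by
  have h1 := one_le_logb_two hn
  have h2 := clog_le_two_mul_logb hn
  set L := Real.logb 2 n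
  have h3 : (1 : ℝ) ≤ L / ε := by rw [le_div_iff₀ hε]; linarith
  have h4 : (((2 * (a + 2) * Nat.clog 2 n : ℕ) : ℝ) + 1) ≤ (4 * a + 9) * L := by
    push_cast
    have ha : (0 : ℝ) ≤ a := by positivity
    nlinarith
  have h5 : (((2 * (a + 2) * Nat.clog 2 n : ℕ) : ℝ) + 1) / ε ≤ (4 * a + 9) * (L / ε) := by
    rw [← mul_div_assoc]
    exact div_le_div_of_nonneg_right h4 hε.le
  rw [mul_div_assoc] at hm
  push_cast
  push_cast at hm h5
  nlinarith

theorem shortcut_rounds_le {n d : ℕ} (hn : 2 ≤ n) {ε : ℝ} (hε : 0 < ε) (hε' : ε ≤ 1) :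
    ((Nat.clog 2 n * productRounds (2 * (d + 1) * Nat.clog 2 n) + 1 : ℕ) : ℝ) ≤
      (577 + 512 * d) * (Real.logb 2 n ^ 2 / ε) := by
  have h1 := one_le_logb_two hn
  have h2 := clog_le_two_mul_logb hn
  have hℓ : (0 : ℝ) ≤ Nat.clog 2 n := by positivity
  set L := Real.logb 2 n
  set ℓ : ℝ := (Nat.clog 2 n : ℝ)
  have hZ : L ^ 2 ≤ L ^ 2 / ε := by rw [le_div_iff₀ hε]; nlinarith [sq_nonneg L]
  have hℓ2 : ℓ * ℓ ≤ 4 * L ^ 2 := by nlinarith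
  have hd : (0 : ℝ) ≤ d := by positivity
  have e1 : ℓ * (32 + 64 * (2 * (d + 1) * ℓ)) ≤ (576 + 512 * d) * L ^ 2 := by
    have : (d + 1) * (ℓ * ℓ) ≤ (d + 1) * (4 * L ^ 2) :=
      mul_le_mul_of_nonneg_left hℓ2 (by positivity)
    nlinarith
  have e3 : ((576 : ℝ) + 512 * d) * L ^ 2 ≤ (576 + 512 * d) * (L ^ 2 / ε) :=
    mul_le_mul_of_nonneg_left hZ (by positivity)
  have e4 : (1 : ℝ) ≤ L ^ 2 / ε := le_trans (by nlinarith) hZ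
  unfold productRounds
  push_cast
  linarith

theorem query_rounds_le {n a c d m : ℕ} (hn : 2 ≤ n) {ε : ℝ} (hε : 0 < ε) (hε' : ε ≤ 1)
    (hm : ((8 * m + 7 : ℕ) : ℝ) ≤ (256 * a + 591) * (Real.logb 2 n / ε)) :
    ((Nat.clog 2 n * productRounds (2 * (d + 1) * Nat.clog 2 n) + 1 +
      (8 * m + 7) * productRounds (c + 1) : ℕ) : ℝ) ≤
      (577 + 512 * d + (256 * a + 591) * (96 + 64 * c)) * (Real.logb 2 n ^ 2 / ε) := by
  have h1 := one_le_logb_two hn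
  have h0 := shortcut_rounds_le (d := d) hn hε hε'
  set L := Real.logb 2 n
  have hLZ : L / ε ≤ L ^ 2 / ε := div_le_div_of_nonneg_right (by nlinarith) hε.le
  have e2 : (((8 * m + 7) * productRounds (c + 1) : ℕ) : ℝ) ≤
      (256 * a + 591) * (96 + 64 * c) * (L ^ 2 / ε) := by
    have hp : ((productRounds (c + 1) : ℕ) : ℝ) = 96 + 64 * c := by
      unfold productRounds; push_cast; ring
    rw [Nat.cast_mul, hp]
    calc _ ≤ (256 * a + 591) * (L / ε) * (96 + 64 * (c : ℝ)) :=
          mul_le_mul_of_nonneg_right hm (by positivity)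
      _ ≤ (256 * a + 591) * (L ^ 2 / ε) * (96 + 64 * (c : ℝ)) := by gcongr
      _ = _ := by ring
  rw [Nat.cast_add]
  exact (add_le_add h0 e2).trans (by rw [← add_mul])

theorem preprocessing_rounds_le {n a d m : ℕ} (hn : 2 ≤ n) {ε : ℝ} (hε : 0 < ε) (hε' : ε ≤ 1)
    (hm : ((8 * m + 7 : ℕ) : ℝ) ≤ (256 * a + 591) * (Real.logb 2 n / ε)) :
    ((1 + (Nat.clog 2 n * productRounds (2 * (d + 1) * Nat.clog 2 n) + 1) +
      2 * (a + 2) * Nat.clog 2 n * ((8 * m + 7) * productRounds 1) : ℕ) : ℝ) ≤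
      (578 + 512 * d + 384 * (a + 2) * (256 * a + 591)) * (Real.logb 2 n ^ 2 / ε) := by
  have h1 := one_le_logb_two hn
  have h2 := clog_le_two_mul_logb hn
  have h0 := shortcut_rounds_le (d := d) hn hε hε'
  set L := Real.logb 2 n
  have e4 : (1 : ℝ) ≤ L ^ 2 / ε := by rw [le_div_iff₀ hε]; nlinarith
  have e2 : ((2 * (a + 2) * Nat.clog 2 n * ((8 * m + 7) * productRounds 1) : ℕ) : ℝ) ≤
      384 * (a + 2) * (256 * a + 591) * (L ^ 2 / ε) := by
    have hp : ((productRounds 1 : ℕ) : ℝ) = 96 := by unfold productRounds; norm_num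
    rw [Nat.cast_mul, Nat.cast_mul (8 * m + 7), hp]
    push_cast at hm ⊢
    calc _ ≤ (2 * (a + 2) * (2 * L)) * (((256 * a + 591) * (L / ε)) * 96) := by gcongr
      _ = _ := by ring
  rw [Nat.cast_add, Nat.cast_add]
  refine (add_le_add (add_le_add_right h0 _) e2).trans ?_
  push_cast
  linarith

theorem dataSize_bound {n m C : ℕ} {k : ℝ} (hn : 2 ≤ n) (hk : 2 ≤ k) (hC : 5 ≤ C) {s : ℕ}
    (hs : s ≤ n + 2 * m + 4 * n) :
    (s : ℝ) ≤ C * ((m : ℝ) + (n : ℝ) ^ (1 + 1 / (2 * k))) := by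
  have h1 : (n : ℝ) ≤ (n : ℝ) ^ (1 + 1 / (2 * k)) := by
    have hn1 : (1 : ℝ) ≤ n := by exact_mod_cast (by omega : 1 ≤ n)
    have hk1 : (0 : ℝ) ≤ 1 / (2 * k) := by positivity
    simpa using Real.rpow_le_rpow_of_exponent_le hn1 (by linarith : (1 : ℝ) ≤ 1 + 1 / (2 * k))
  have h2 : (s : ℝ) ≤ n + 2 * m + 4 * n := by exact_mod_cast hs
  have h3 : (5 : ℝ) ≤ C := by exact_mod_cast hC
  have h4 : (0 : ℝ) ≤ m := by positivity
  have h5 : (0 : ℝ) ≤ n := by positivity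
  nlinarith

theorem mainTheorem3 (a c d : ℕ) :
    ∃ C : ℕ, ∀ n : ℕ, 2 ≤ n → ∀ k ε : ℝ, 2 ≤ k → 0 < ε → ε ≤ 1 →
      ∃ (r : ℕ) (P : Preprocessing n (C * Nat.clog 2 n) r) (Q : Query n (C * Nat.clog 2 n)),
        (P.rounds : ℝ) ≤ C * (hopBeta n k ε * Real.logb 2 n ^ 2) ∧
        (Q.rounds : ℝ) ≤ C * hopBeta n k ε ∧
        ∀ G : WGraph n, G.PolyWeights a →
          (∀ ω : Fin n → Coins r,
            (dataSize (P.build G ω) : ℝ) ≤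
              C * ((G.numEdges : ℝ) + (n : ℝ) ^ (1 + 1 / (2 * k)))) ∧
          1 - 1 / (n : ℝ) ^ d ≤
            coinProb {ω : Fin n → Coins r |
              ∀ S : Finset (Fin n), (S.card : ℝ) ≤ c * Real.sqrt n →
                ∀ s ∈ S, ∀ v : Fin n,
                  G.dist s v ≤ Q.answer (P.build G ω) S v s ∧
                  Q.answer (P.build G ω) S v s ≤ ENNReal.ofReal (1 + ε) * G.dist s v} := by
  classical
  -- The sum of the constants of `preprocessing_rounds_le`, of the remaining part of
  -- `query_rounds_le`, and of the word length in `card_entry_le`.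
  set K : ℕ := 578 + 512 * d + 384 * (a + 2) * (256 * a + 591) +
    (256 * a + 591) * (96 + 64 * c) + (a + 5) with hK
  refine ⟨K, fun n hn k ε hk hε hε' => ?_⟩
  have hn0 : 0 < n := by omega
  have : NeZero n := ⟨hn0.ne'⟩
  set ℓ := Nat.clog 2 n with hℓ
  have hℓ0 : 0 < ℓ := Nat.clog_pos (by norm_num) hn
  have hnℓ : n ≤ 2 ^ ℓ := Nat.le_pow_clog (by norm_num) n
  set q := Nat.sqrt n + 1 with hqdef
  have hq : n ≤ q * q := (Nat.lt_succ_sqrt n).le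
  have hq' : q * q ≤ 4 * n := by
    have h1 := Nat.sqrt_le n
    have h2 : 1 ≤ Nat.sqrt n := Nat.le_sqrt.2 (by omega)
    rw [hqdef]; nlinarith
  -- Finite distances are at most n^(a+1), so even estimates that are off by a factor 2 stay below
  -- `M`.
  set M := 4 * n ^ (a + 1) with hMdef
  set t := 2 * (d + 1) * ℓ with ht
  -- Since (3/2)² ≥ 2, the last scale (3/2)^J / 2 exceeds every finite distance.
  set J := 2 * (a + 2) * ℓ with hJ
  set m := ⌈8 * ((J : ℝ) + 1) / ε⌉₊ with hm
  have hm1 : 8 * ((J : ℝ) + 1) / ε ≤ m := Nat.le_ceil _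
  have hm2 : (m : ℝ) ≤ 8 * ((J : ℝ) + 1) / ε + 1 := (Nat.ceil_lt_add_one (by positivity)).le
  have hm6 : 6 ≤ m := by
    have h1 : (6 : ℝ) ≤ 8 * ((J : ℝ) + 1) / ε := by
      rw [le_div_iff₀ hε]
      have : (0 : ℝ) ≤ J := by positivity
      linarith
    exact_mod_cast h1.trans hm1
  have hops := hops_le (a := a) hn hε hε' hm2
  have hB : Fintype.card (Entry n M) ≤ 2 ^ (K * ℓ) :=
    card_entry_le hn (Nat.mul_le_mul_right _ (by omega))
  have hB' : 2 ≤ 2 ^ (K * ℓ) :=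
    le_self_pow₀ (by norm_num) (Nat.mul_pos (by omega) hℓ0).ne'
  obtain ⟨enc⟩ : Nonempty (Entry n M ↪ Word (K * ℓ)) :=
    Function.Embedding.nonempty_of_card_le (by simpa using hB)
  obtain ⟨r, sample, hsample, hrare⟩ := exists_sampler (t := t) (d := d) hn hq (by
    rw [ht]; push_cast
    exact mul_le_mul_of_nonneg_left (log_le_clog hn) (by positivity))
  obtain ⟨P, hPr, hP⟩ := realizes_preprocessing hn0 hq hq' hB hB' enc sample t ℓ (8 * m + 7) J
  obtain ⟨Q, hQr, hQ⟩ := realizes_query hn0 hq hq' hB enc t (c + 1) ℓ (8 * m + 7)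
  have hβ := le_hopBeta hn hk hε hε'
  have hL := one_le_logb_two hn
  have hZ : (0 : ℝ) ≤ Real.logb 2 n ^ 2 / ε := by positivity
  refine ⟨r, P, Q, ?_, ?_, fun G hG => ?_⟩
  · rw [hPr]
    refine (preprocessing_rounds_le hn hε hε' hops).trans ?_
    refine mul_le_mul ?_ ?_ hZ (by positivity)
    · rw [hK]; push_cast
      have : (0 : ℝ) ≤ (256 * a + 591) * (96 + 64 * c) + (a + 5) := by positivity
      linarith
    · refine hβ.trans (le_mul_of_one_le_right (hZ.trans hβ) ?_)
      exact one_le_pow₀ hL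
  · rw [hQr]
    refine (query_rounds_le hn hε hε' hops).trans ?_
    refine mul_le_mul ?_ hβ hZ (by positivity)
    rw [hK]; push_cast
    have : (0 : ℝ) ≤ 384 * (a + 2) * (256 * a + 591) + (a + 5) := by positivity
    linarith
  have hbuild : ∀ (ω : Fin n → Coins r) v, Preprocessing.build P G ω v =
      storeRow enc (storedRow M (q * 1) (q * t) ℓ (8 * m + 7) J
        G.weightMatrix (sample (ω ⟨0, hn0⟩)) v) := fun ω v => hP _ v
  constructor
  · intro ω
    refine dataSize_bound hn hk (by omega) ?_
    unfold dataSize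
    simp only [hbuild, length_storeRow]
    exact (sum_card_storedRow_ne_top G _ (hsample _)).trans (by omega)
  have hd := hG.isPathMetric
  have hna : 1 ≤ n ^ (a + 1) := Nat.one_le_pow _ _ hn0
  have hM : ∀ v u, G.natDist v u ≠ ⊤ → 2 * G.natDist v u < M := by
    intro v u h
    have h1 := hG.natDist_le h
    obtain ⟨D, hD⟩ := ENat.ne_top_iff_exists.1 h
    rw [← hD] at h1 ⊢
    rw [hMdef]
    norm_cast at h1 ⊢
    omega
  have hWM : ∀ v u, G.weightMatrix v u ≠ ⊤ → G.weightMatrix v u < M := by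
    intro v u h
    refine (hG.weightMatrix_le h).trans_lt ?_
    rw [hMdef]
    have : n ^ a ≤ n ^ (a + 1) := Nat.pow_le_pow_right hn0 (Nat.le_succ a)
    norm_cast
    omega
  have good : ∀ ω : Fin n → Coins r,
      HitsNearest (q * t) G.natDist (sample (ω ⟨0, hn0⟩)) →
      ∀ S : Finset (Fin n), (S.card : ℝ) ≤ c * Real.sqrt n → ∀ s ∈ S, ∀ v : Fin n,
        G.dist s v ≤ Query.answer Q (Preprocessing.build P G ω) S v s ∧
        Query.answer Q (Preprocessing.build P G ω) S v s ≤ ENNReal.ofReal (1 + ε) * G.dist s v := by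
    intro ω hω S hS s hs v
    have hans : Query.answer Q (Preprocessing.build P G ω) S v s = ((relax M (q * (c + 1)) (8 * m + 7)
        (withShortcuts M (q * t) ℓ (fun v u => truncAt M (storedRow M (q * 1) (q * t) ℓ (8 * m + 7)
          J G.weightMatrix (sample (ω ⟨0, hn0⟩)) v u))) S v s : ℕ∞) : ℝ≥0∞) := by
      have hflag : (flagSet fun v => decide (v ∈ S)) = S := by ext v; simp [mem_flagSet]
      unfold Query.answer
      rw [hQ]
      simp only [hbuild, loadRow_storeRow, hflag]
    have hcard : S.card ≤ q * (c + 1) := by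
      have h1 : Real.sqrt n ≤ q := by
        rw [Real.sqrt_le_left (by positivity), sq]
        exact_mod_cast hq
      have h2 : (S.card : ℝ) ≤ q * (c + 1) := by
        have hc0 : (0 : ℝ) ≤ c := by positivity
        have hq0 : (0 : ℝ) ≤ q := by positivity
        nlinarith
      exact_mod_cast h2
    rw [hans, G.dist_eq_natDist, hd.symm s v]
    refine ⟨ENat.toENNReal_le.2 (hd.le_answer _ S v s), ?_⟩
    by_cases hfin : G.natDist v s = ⊤
    · rw [hfin, ENat.toENNReal_top, ENNReal.mul_top]
      · exact le_top
      · simp only [ne_eq, ENNReal.ofReal_eq_zero, not_le]; linarith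
    obtain ⟨D, hD⟩ := ENat.ne_top_iff_exists.1 hfin
    have hDle : (D : ℝ) ≤ (3 / 2) ^ J / 2 := by
      have h1 := hG.natDist_le hfin
      rw [← hD] at h1
      have h2 : D ≤ n ^ (a + 1) := by exact_mod_cast h1
      exact le_trans (by exact_mod_cast h2) (pow_le_three_halves_pow hn)
    obtain ⟨l, hl, hl'⟩ := hd.answer_le (κ := q * 1) hM hWM hnℓ hω
      (by rw [mul_one]; exact hsample _) hm6 hε' (one_add_four_div_pow_le hε hε' hm1) hcard hs
      hD.symm hDle
    refine (ENat.toENNReal_le.2 hl).trans ?_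
    rw [← hD, ENat.toENNReal_coe, ENat.toENNReal_coe, ← ENNReal.ofReal_natCast l,
      ← ENNReal.ofReal_natCast D, ← ENNReal.ofReal_mul (by linarith)]
    exact ENNReal.ofReal_le_ofReal hl'
  -- For small n the `q * t` nearest nodes may be all nodes; then no pivots are needed and the
  -- success is certain.
  by_cases hkn : q * t ≤ n
  · have hF := hrare (fun v => Finset.univ.filter (fun s => rankOf (G.natDist v) s < q * t))
      (fun v => by rw [card_rankOf_lt, min_eq_left hkn])
    rw [div_eq_mul_one_div] at hF
    refine one_sub_le_coinProb ⟨0, hn0⟩ _ hF fun ω hω => good ω fun v => Or.inl ?_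
    rw [not_exists] at hω
    obtain ⟨p, hp, hp'⟩ := Finset.not_disjoint_iff.1 (hω v)
    exact ⟨p, hp, by simpa using hp'⟩
  · have hall : ∀ ω : Fin n → Coins r, HitsNearest (q * t) G.natDist (sample (ω ⟨0, hn0⟩)) :=
      fun ω v => Or.inr fun s => (rankOf_lt _ s).trans_le (by omega)
    refine one_sub_le_coinProb ⟨0, hn0⟩ (fun _ => False) ?_ fun ω _ => good ω (hall ω)
    simp only [Finset.filter_false, Finset.card_empty, Nat.cast_zero]
    positivity
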